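/- Notation. Let $d\ge 1$, let $f:\mathbb{R}^d\to(0,\infty)$ (in the application $f=\pi/\phi$, with $\pi$ the positive target density and $\phi$ the standard Gaussian density on $\mathbb{R}^d$), and put $\Delta_l=2^{-l}$ for $l\in\mathbb{N}_0=\{0,1,2,\dots\}$; $\mathbb{N}=\{1,2,\dots\}$. For $x\in\mathbb{R}^d$ and $t\in[0,1)$ let $$b(x,t)=\nabla_x\log\mathbb{E}\big[f(x+\sqrt{1-t}\,Z)\big],\qquad Z\sim\mathcal{N}_d(0,I).$$ Let $W$ be a standard $d$-dimensional Brownian motion and, independently of it, let $Z^1,\dots,Z^N$ be i.i.d. $\mathcal{N}_d(0,I)$ variables; put $$\hat b(x,t)=\frac{\frac1N\sum_{i=1}^N\nabla f(x+\sqrt{1-t}\,Z^i)}{\frac1N\sum_{i=1}^N f(x+\sqrt{1-t}\,Z^i)}.$$ For $l\in\mathbb{N}_0$ define, with $\widetilde X_0^{l}=\widetilde X_0^{l,N}=0$ and for $k\in\{0,\dots,2^l-1\}$, $$\widetilde X_{(k+1)\Delta_l}^{l}=\widetilde X_{k\Delta_l}^{l}+b(\widetilde X_{k\Delta_l}^{l},k\Delta_l)\Delta_l+W_{(k+1)\Delta_l}-W_{k\Delta_l},$$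 $$\widetilde X_{(k+1)\Delta_l}^{l,N}=\widetilde X_{k\Delta_l}^{l,N}+\hat b(\widetilde X_{k\Delta_l}^{l,N},k\Delta_l)\Delta_l+W_{(k+1)\Delta_l}-W_{k\Delta_l},$$ where the same Brownian motion $W$ is used in all the schemes at all levels, and the same $Z^1,\dots,Z^N$ at all times and all levels. Assumption (A1): $f$ is twice continuously differentiable and (a) there are $0<\underline{C}<\overline{C}<\infty$ such that $\underline{C}\le f(x)\le\overline{C}$, $\|\nabla f(x)\|_1\le\overline{C}$ and $\|\nabla^2 f(x)\|_1\le\overline{C}$ for all $x\in\mathbb{R}^d$; (b) there is $C<\infty$ such that for all $x,y\in\mathbb{R}^d$ $$\max\{|f(x)-f(y)|,\ \|\nabla f(x)-\nabla f(y)\|_1,\ \|\nabla^2 f(x)-\nabla^2 f(y)\|_1\}\le C\|x-y\|_2 .$$ Here $\|\cdot\|_1$ is the sum of the absolute values of the entries. Proposition. Assume (A1). Let $\varphi:\mathbb{R}^d\to\mathbb{R}$ be bounded and measurable, with partial derivatives $\partial\varphi/\partial x_k$, $k=1,\dots,d$, that exist everywhere and are bounded and Lipschitz. Then there is a constant $C<\infty$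 such that for all $(l,N)\in\mathbb{N}^2$ $$\mathbb{E}\Big[\Big(\big(\varphi(\widetilde X_1^{l,N})-\varphi(\widetilde X_1^{l-1,N})\big)-\big(\varphi(\widetilde X_1^{l})-\varphi(\widetilde X_1^{l-1})\big)\Big)^2\Big]\le\frac{C\Delta_l}{N}.$$ -/

import Mathlib

open MeasureTheory ProbabilityTheory
open scoped NNReal Gradient

universe u

noncomputable section

namespace SchrodingerFollmer

/-- The state space `ℝ^d` with its Euclidean norm. -/
abbrev E (d : ℕ) : Type := EuclideanSpace ℝ (Fin d)

/-- The partial derivative `∂ψ/∂x_k` at `x`. -/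
def partialDeriv {d : ℕ} (k : Fin d) (ψ : E d → ℝ) (x : E d) : ℝ :=
  lineDeriv ℝ ψ x (EuclideanSpace.single k 1)

/-- `∂ψ/∂x_k` exists at every point. -/
def HasPartialDeriv {d : ℕ} (k : Fin d) (ψ : E d → ℝ) : Prop :=
  ∀ x, LineDifferentiableAt ℝ ψ x (EuclideanSpace.single k 1)

/-- The Hessian matrix `∇²ψ(x)` of second partial derivatives. -/
def hessian {d : ℕ} (ψ : E d → ℝ) (x : E d) : Matrix (Fin d) (Fin d) ℝ :=
  Matrix.of fun j k => partialDeriv j (partialDeriv k ψ) x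

/-- The `L₁`-norm of a vector. -/
def vecL1 {d : ℕ} (v : E d) : ℝ := ∑ k, |v k|

/-- The (entrywise) `L₁`-norm of a matrix. -/
def matL1 {d : ℕ} (A : Matrix (Fin d) (Fin d) ℝ) : ℝ := ∑ j, ∑ k, |A j k|

/-- `Lip(ℝ^d)`: measurable functions that are Lipschitz for the Euclidean norm. -/
def IsLip {d : ℕ} (ψ : E d → ℝ) : Prop :=
  Measurable ψ ∧ ∃ C : ℝ, ∀ x y, |ψ x - ψ y| ≤ C * ‖x - y‖

/-- `B_b(ℝ^d)`: bounded measurable functions. -/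
def IsBoundedMeasurable {d : ℕ} (ψ : E d → ℝ) : Prop :=
  Measurable ψ ∧ ∃ C : ℝ, ∀ x, |ψ x| ≤ C

/-- Assumption (A1) on the likelihood function `f`. -/
structure AssumptionA1 {d : ℕ} (f : E d → ℝ) : Prop where
  contDiff : ContDiff ℝ 2 f
  bounds : ∃ c C : ℝ, 0 < c ∧ c < C ∧ ∀ x,
    c ≤ f x ∧ f x ≤ C ∧ vecL1 (∇ f x) ≤ C ∧ matL1 (hessian f x) ≤ C
  lipschitz : ∃ C : ℝ, ∀ x y,
    max |f x - f y| (max (vecL1 (∇ f x - ∇ f y)) (matL1 (hessian f x - hessian f y)))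
      ≤ C * ‖x - y‖

/-- `E_{x,t}[f(W_1)] = E[f(x + √(1-t) Z)]` with `Z ∼ N_d(0, I)`, for `t ∈ [0,1]`. -/
def heatExpectation {d : ℕ} (f : E d → ℝ) (x : E d) (t : ℝ) : ℝ :=
  ∫ z, f (x + √(1 - t) • z) ∂(stdGaussian (E d))

/-- The exact drift `b(x,t) = ∇ log E_{x,t}[f(W_1)]`, the gradient being taken in `x`. -/
def drift {d : ℕ} (f : E d → ℝ) (x : E d) (t : ℝ) : E d :=
  ∇ (fun y => Real.log (heatExpectation f y t)) x

/-- The Monte Carlo drift `b̂(x,t)` built from the `N` points `z 0, …, z (N-1)`. -/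
def mcDrift {d N : ℕ} (f : E d → ℝ) (z : Fin N → E d) (x : E d) (t : ℝ) : E d :=
  ((1 / (N : ℝ)) * ∑ i, f (x + √(1 - t) • z i))⁻¹ •
    ((1 / (N : ℝ)) • ∑ i, ∇ f (x + √(1 - t) • z i))

/-- The step size `Δ_l = 2^{-l}`. -/
def step (l : ℕ) : ℝ≥0 := (2 ^ l)⁻¹

/-- The Euler scheme with step `Δ_l`, started at `0`, for drift `β` and driving path `w`;
`euler β l w k` is its value at time `k Δ_l`. -/
def euler {d : ℕ} (β : E d → ℝ → E d) (l : ℕ) (w : ℝ≥0 → E d) : ℕ → E d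
  | 0 => 0
  | k + 1 => euler β l w k + (step l : ℝ) • β (euler β l w k) ((k * step l : ℝ≥0) : ℝ)
      + (w ((k + 1) * step l) - w (k * step l))

/-- `X̃_1^l`, the value at time `1` of the exact Euler scheme. -/
def eulerExact {d : ℕ} (f : E d → ℝ) (l : ℕ) (w : ℝ≥0 → E d) : E d :=
  euler (drift f) l w (2 ^ l)

/-- `X̃_1^{l,N}`, the value at time `1` of the Euler scheme with Monte Carlo drift; the same
points `z` are used at all times. -/
def eulerMC {d N : ℕ} (f : E d → ℝ) (l : ℕ) (w : ℝ≥0 → E d) (z : Fin N → E d) : E d :=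
  euler (mcDrift f z) l w (2 ^ l)

/-- `W` is a standard `d`-dimensional Brownian motion: its coordinates are independent real
standard Brownian motions. -/
structure IsBrownianMotion {d : ℕ} {Ω : Type*} [MeasurableSpace Ω] (W : ℝ≥0 → Ω → E d)
    (P : Measure Ω) : Prop where
  coord : ∀ i, IsBrownianReal (fun t ω => W t ω i) P
  indep : iIndepFun (fun (i : Fin d) (ω : Ω) (t : ℝ≥0) => W t ω i) P

/-- The random inputs: a standard `d`-dimensional Brownian motion `W` and, independently of it,
i.i.d. `N_d(0, I)` variables `Z 0, …, Z (N-1)`. -/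
structure IsSamplingInput {d N : ℕ} {Ω : Type*} [MeasurableSpace Ω] (W : ℝ≥0 → Ω → E d)
    (Z : Fin N → Ω → E d) (P : Measure Ω) : Prop where
  brownian : IsBrownianMotion W P
  gaussian : ∀ i, HasLaw (Z i) (stdGaussian (E d)) P
  indep_Z : iIndepFun Z P
  indep_W_Z : IndepFun (fun ω t => W t ω) (fun ω i => Z i ω) P

/-- The double difference
`(φ(X̃_1^{l,N}) - φ(X̃_1^{l-1,N})) - (φ(X̃_1^l) - φ(X̃_1^{l-1}))`, for `l ≥ 1`, all four schemes
being driven by the same `w` and both Monte Carlo schemes using the same `z`. -/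
def doubleDifference {d N : ℕ} (f φ : E d → ℝ) (l : ℕ) (w : ℝ≥0 → E d) (z : Fin N → E d) : ℝ :=
  (φ (eulerMC f l w z) - φ (eulerMC f (l - 1) w z))
    - (φ (eulerExact f l w) - φ (eulerExact f (l - 1) w))

end SchrodingerFollmer

end

/-! Both drifts are the same functional of a probability measure `μ`: the mean of `∇f(x + √(1-t) z)`
under `μ` divided by the mean of `f(x + √(1-t) z)`. Gaussian `μ` gives the exact drift
(`drift_eq_ratioDrift`), empirical `μ` the Monte Carlo drift (`mcDrift_eq_ratioDrift`). The claim is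
that in `L²` the second difference (Monte Carlo against exact, fine against coarse) has the size
`N^{-1/2} Δ_l^{1/2}` of the product of the two separate errors.

The product structure comes from the four-point inequality `|ψ(a) - ψ(b) - ψ(c) + ψ(e)| ≤ A
(‖a-b-c+e‖ + (‖a-c‖ + ‖b-e‖) ‖c-e‖)`, valid whenever the partial derivatives of `ψ` are bounded and
Lipschitz (`exists_fourPoint`); thus for `f`, for its partial derivatives and for `φ`. It survives
averaging and division, so it holds for the drifts, up to terms that measure how far empirical means
are from Gaussian ones (`DriftData.norm_ratioDrift_four_point_le`).

Fix the Brownian path. The exact schemes are then deterministic, and all deviations of means are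
evaluated at their points only, where the empirical means average i.i.d. variables. No uniform law
of large numbers is needed: a variance computation gives `N^{-1/2}` for a deviation, and `N^{-1/2}`
times the distance for its variation between two points (`l2Le_mean_sub_mean_sub`). Discrete
Grönwall arguments (`L2Le.gronwall`) then bound Monte Carlo against exact by `N^{-1/2}`, and the
second difference by `N^{-1/2}` times the accumulated gap between the exact fine and coarse schemes
(`DriftData.l2Le_secondDifference`).

That gap depends on the path alone and is of order `Δ_l^{1/2}` in `L²` (`DriftData.l2Le_level_sub`).
As the path and the samples are independent, the joint law is a product, and fibrewise `L²` bounds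
integrate (`L2Le.prod`), so the two orders multiply without higher moments. -/

namespace SchrodingerFollmer

/-! ### Four-point estimates from bounded Lipschitz partial derivatives -/

/-- Four-point regularity: the second difference of `ψ` over the quadruple `a, b, c, e` is
controlled as for a function with bounded and Lipschitz gradient. -/
structure FourPoint {d : ℕ} (ψ : E d → ℝ) (A : ℝ) : Prop where
  nonneg : 0 ≤ A
  bound : ∀ a b c e, |ψ a - ψ b - ψ c + ψ e|
    ≤ A * (‖a - b - c + e‖ + (‖a - c‖ + ‖b - e‖) * ‖c - e‖)

variable {d : ℕ} {ψ : E d → ℝ} {A : ℝ}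

theorem FourPoint.mono (h : FourPoint ψ A) {B : ℝ} (hAB : A ≤ B) : FourPoint ψ B where
  nonneg := h.nonneg.trans hAB
  bound a b c e := (h.bound a b c e).trans (by gcongr)

/-- The degenerate quadruple `a, b, b, b` makes the product term vanish. -/
theorem FourPoint.lipschitz (h : FourPoint ψ A) (a b : E d) : |ψ a - ψ b| ≤ A * ‖a - b‖ := by
  simpa using h.bound a b b b

theorem FourPoint.continuous (h : FourPoint ψ A) : Continuous ψ := by
  refine (LipschitzWith.of_dist_le_mul (K := ⟨A, h.nonneg⟩) fun x y => ?_).continuous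
  rw [Real.dist_eq, dist_eq_norm]
  exact h.lipschitz x y

theorem abs_coord_le_norm (v : E d) (k : Fin d) : |v k| ≤ ‖v‖ := by
  simpa using PiLp.norm_apply_le v k

theorem norm_single_one (k : Fin d) : ‖(EuclideanSpace.single k 1 : E d)‖ = 1 := by simp

theorem hasDerivAt_along_coord {k : Fin d} (h : HasPartialDeriv k ψ) (x : E d) (α θ : ℝ) :
    HasDerivAt (fun r : ℝ => ψ (x + (r * α) • EuclideanSpace.single k 1))
      (partialDeriv k ψ (x + (θ * α) • EuclideanSpace.single k 1) * α) θ := by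
  set v : E d := EuclideanSpace.single k 1
  have h1 : HasDerivAt (fun t : ℝ => ψ (x + (θ * α) • v + t • v))
      (partialDeriv k ψ (x + (θ * α) • v)) 0 := (h (x + (θ * α) • v)).hasLineDerivAt
  have h2 : HasDerivAt (fun r : ℝ => r * α - θ * α) α θ := by
    simpa using ((hasDerivAt_id θ).mul_const α).sub_const (θ * α)
  have h3 := HasDerivAt.comp (h₂ := fun t : ℝ => ψ (x + (θ * α) • v + t • v)) θ
    (by simpa using h1) h2
  convert! h3 using 2
  simp only [Function.comp_apply]
  congr 1
  rw [sub_smul]; abel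

/-- The four-point estimate for increments along a single coordinate direction. -/
theorem four_point_along_coord {K : ℝ} (hK : 0 ≤ K) {k : Fin d} (h : HasPartialDeriv k ψ)
    (hb : ∀ x, |partialDeriv k ψ x| ≤ K)
    (hl : ∀ x y, |partialDeriv k ψ x - partialDeriv k ψ y| ≤ K * ‖x - y‖)
    (x y : E d) (α β : ℝ) :
    |ψ (x + α • EuclideanSpace.single k 1) - ψ x - ψ (y + β • EuclideanSpace.single k 1) + ψ y|
      ≤ K * |α - β| + K * |β| * (‖x - y‖ + |α - β|) := by
  set v : E d := EuclideanSpace.single k 1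
  have hv : ‖v‖ = 1 := norm_single_one k
  -- Between `θ = 0` and `θ = 1` this function changes by exactly the second difference, so a bound
  -- on its derivative suffices.
  have hd : ∀ θ ∈ Set.Icc (0 : ℝ) 1, HasDerivWithinAt
      (fun r : ℝ => ψ (x + (r * α) • v) - ψ (y + (r * β) • v))
      (partialDeriv k ψ (x + (θ * α) • v) * α - partialDeriv k ψ (y + (θ * β) • v) * β)
      (Set.Icc 0 1) θ := fun θ _ =>
    ((hasDerivAt_along_coord h x α θ).sub (hasDerivAt_along_coord h y β θ)).hasDerivWithinAt
  have hbd : ∀ θ ∈ Set.Ico (0 : ℝ) 1,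
      ‖partialDeriv k ψ (x + (θ * α) • v) * α - partialDeriv k ψ (y + (θ * β) • v) * β‖
        ≤ K * |α - β| + K * |β| * (‖x - y‖ + |α - β|) := by
    intro θ hθ
    set p := partialDeriv k ψ (x + (θ * α) • v)
    set q := partialDeriv k ψ (y + (θ * β) • v)
    have e1 : p * α - q * β = p * (α - β) + (p - q) * β := by ring
    have e2 : |p - q| ≤ K * (‖x - y‖ + |α - β|) := by
      refine (hl _ _).trans (mul_le_mul_of_nonneg_left ?_ hK)
      have : x + (θ * α) • v - (y + (θ * β) • v) = (x - y) + (θ * (α - β)) • v := by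
        rw [mul_sub, sub_smul]; abel
      rw [this]
      refine (norm_add_le _ _).trans (add_le_add_right ?_ _)
      rw [norm_smul, hv, mul_one, Real.norm_eq_abs, abs_mul, abs_of_nonneg hθ.1]
      exact mul_le_of_le_one_left (abs_nonneg _) hθ.2.le
    rw [e1, Real.norm_eq_abs]
    calc |p * (α - β) + (p - q) * β| ≤ |p * (α - β)| + |(p - q) * β| := abs_add_le _ _
      _ = |p| * |α - β| + |p - q| * |β| := by rw [abs_mul, abs_mul]
      _ ≤ K * |α - β| + (K * (‖x - y‖ + |α - β|)) * |β| := by gcongr; exact hb _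
      _ = _ := by ring
  have := norm_image_sub_le_of_norm_deriv_le_segment_01' hd hbd
  simp only [one_mul, zero_mul, zero_smul, add_zero, Real.norm_eq_abs] at this
  convert this using 2
  ring

/-- A function with bounded, Lipschitz partial derivatives satisfies the four-point estimate. -/
theorem exists_fourPoint {K : ℝ} (hK : 0 ≤ K)
    (h : ∀ k, HasPartialDeriv k ψ) (hb : ∀ k x, |partialDeriv k ψ x| ≤ K)
    (hl : ∀ k x y, |partialDeriv k ψ x - partialDeriv k ψ y| ≤ K * ‖x - y‖) :
    ∃ A, FourPoint ψ A := by
  -- Only partial derivatives are given, so increments are taken one coordinate at a time: induction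
  -- on the set `s` of coordinates in which `a` may differ from `b`, and `c` from `e`.
  have key : ∀ s : Finset (Fin d), ∃ A : ℝ, 0 ≤ A ∧ ∀ a b c e : E d,
      (∀ i ∉ s, a i = b i) → (∀ i ∉ s, c i = e i) →
      |ψ a - ψ b - ψ c + ψ e| ≤ A * (‖a - b - c + e‖ + (‖a - c‖ + ‖b - e‖) * ‖c - e‖) := by
    intro s
    induction s using Finset.induction_on with
    | empty =>
      refine ⟨0, le_rfl, fun a b c e h1 h2 => ?_⟩
      obtain rfl : a = b := by ext i; exact h1 i (by simp)
      obtain rfl : c = e := by ext i; exact h2 i (by simp)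
      simp
    | insert k s hk ih =>
      obtain ⟨A, hA, ih⟩ := ih
      -- The inductive part costs `A (2D + 6UV)` and the move along coordinate `k` costs `K (D +
      -- 3UV)`, with `D`, `U`, `V` as set below; any constant above `6A + 3K` would do.
      refine ⟨8 * A + 4 * K, by positivity, fun a b c e h1 h2 => ?_⟩
      set v : E d := EuclideanSpace.single k 1
      have hv : ‖v‖ = 1 := norm_single_one k
      have hvk : ∀ i, v i = if i = k then 1 else 0 := fun i => by
        simp [v]
      set α := (a - b) k with hα
      set β := (c - e) k with hβ
      -- `a'` and `c'` take their `k`-th coordinates from `b` and `e`; this changes each relevant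
      -- norm only by a bounded factor.
      set a' := a - α • v with ha'
      set c' := c - β • v with hc'
      have ih' := ih a' b c' e
        (by
          intro i hi
          by_cases hik : i = k
          · subst hik; simp [ha', hvk, hα]
          · simpa [ha', hvk, hik] using h1 i (by simp [hik, hi]))
        (by
          intro i hi
          by_cases hik : i = k
          · subst hik; simp [hc', hvk, hβ]
          · simpa [hc', hvk, hik] using h2 i (by simp [hik, hi]))
      have one := four_point_along_coord hK (h k) (hb k) (hl k) a' c' α β
      have ea : a' + α • v = a := by simp [ha']
      have ec : c' + β • v = c := by simp [hc']
      rw [ea, ec] at one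
      have hαβ : |α - β| ≤ ‖a - b - c + e‖ := by
        have : α - β = (a - b - c + e) k := by simp [hα, hβ]; ring
        rw [this]; exact abs_coord_le_norm _ _
      have hαβ' : |α - β| ≤ ‖a - c‖ + ‖b - e‖ := by
        have : α - β = (a - c) k - (b - e) k := by simp [hα, hβ]; ring
        rw [this]
        exact (abs_sub _ _).trans (add_le_add (abs_coord_le_norm _ _) (abs_coord_le_norm _ _))
      have hβ' : |β| ≤ ‖c - e‖ := abs_coord_le_norm _ _
      have hsm : ∀ r : ℝ, ‖r • v‖ = |r| := fun r => by rw [norm_smul, hv, mul_one]; rfl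
      have n1 : ‖a' - b - c' + e‖ ≤ 2 * ‖a - b - c + e‖ := by
        have : a' - b - c' + e = (a - b - c + e) - (α - β) • v := by
          simp only [ha', hc', sub_smul]; abel
        rw [this]
        refine (norm_sub_le _ _).trans ?_
        rw [hsm]; linarith
      have n2 : ‖a' - c'‖ ≤ 2 * (‖a - c‖ + ‖b - e‖) := by
        have : a' - c' = (a - c) - (α - β) • v := by
          simp only [ha', hc', sub_smul]; abel
        rw [this]
        refine (norm_sub_le _ _).trans ?_
        rw [hsm]; linarith [norm_nonneg (b - e)]
      have n3 : ‖c' - e‖ ≤ 2 * ‖c - e‖ := by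
        have : c' - e = (c - e) - β • v := by simp only [hc']; abel
        rw [this]
        refine (norm_sub_le _ _).trans ?_
        rw [hsm]; linarith
      set D := ‖a - b - c + e‖
      set U := ‖a - c‖ + ‖b - e‖ with hU
      set V := ‖c - e‖
      have hbe : ‖b - e‖ ≤ U := by simp [hU]
      have hU0 : 0 ≤ U := by positivity
      have hD0 : 0 ≤ D := norm_nonneg _
      have hV0 : 0 ≤ V := norm_nonneg _
      have i1 : |ψ a' - ψ b - ψ c' + ψ e| ≤ A * (2 * D + (3 * U) * (2 * V)) := by
        refine ih'.trans ?_
        have : ‖a' - c'‖ + ‖b - e‖ ≤ 3 * U := by linarith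
        gcongr
      have i2 : |ψ a - ψ a' - ψ c + ψ c'| ≤ K * D + K * V * (3 * U) := by
        refine one.trans ?_
        have : ‖a' - c'‖ + |α - β| ≤ 3 * U := by linarith
        gcongr
      calc |ψ a - ψ b - ψ c + ψ e|
          = |(ψ a - ψ a' - ψ c + ψ c') + (ψ a' - ψ b - ψ c' + ψ e)| := by ring_nf
        _ ≤ (K * D + K * V * (3 * U)) + A * (2 * D + (3 * U) * (2 * V)) :=
          (abs_add_le _ _).trans (add_le_add i2 i1)
        _ ≤ (8 * A + 4 * K) * (D + U * V) := by
          have := mul_nonneg hU0 hV0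
          nlinarith [mul_nonneg hA hD0, mul_nonneg hA this, mul_nonneg hK hD0, mul_nonneg hK this]
  obtain ⟨A, hA, hA'⟩ := key Finset.univ
  exact ⟨A, hA, fun a b c e => hA' a b c e (by simp) (by simp)⟩

/-! ### Consequences of (A1) for `f` and its partial derivatives -/

theorem gradient_coord {d : ℕ} {f : E d → ℝ} {x : E d} (hf : DifferentiableAt ℝ f x) (k : Fin d) :
    (∇ f x) k = partialDeriv k f x := by
  have h : inner ℝ (∇ f x) (EuclideanSpace.single k (1 : ℝ)) =
      fderiv ℝ f x (EuclideanSpace.single k 1) := by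
    rw [gradient, InnerProductSpace.toDual_symm_apply]
  rw [partialDeriv, hf.lineDeriv_eq_fderiv, ← h, EuclideanSpace.inner_single_right]
  simp

/-- A family of functions `f, g₁, …, g_d` with a common constant `κ`: `f` is bounded above and
away from zero, the `g k` are bounded, and all satisfy the four-point estimate. -/
structure DriftData {d : ℕ} (f : E d → ℝ) (g : Fin d → E d → ℝ) (κ : ℝ) : Prop where
  one_le : 1 ≤ κ
  lower : ∀ x, κ⁻¹ ≤ f x
  upper : ∀ x, f x ≤ κ
  bound : ∀ k x, |g k x| ≤ κ
  fourPoint : FourPoint f κ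
  fourPoint_g : ∀ k, FourPoint (g k) κ

/-- The bounds on `∇f` give the four-point estimate for `f`; those on the Hessian give it for each
partial derivative. -/
theorem AssumptionA1.exists_driftData {d : ℕ} {f : E d → ℝ} (hf : AssumptionA1 f) :
    ∃ κ, DriftData f (fun k => partialDeriv k f) κ := by
  obtain ⟨c, C, hc, hcC, hb⟩ := hf.bounds
  obtain ⟨L, hL⟩ := hf.lipschitz
  have hC : 0 < C := hc.trans hcC
  have hdf : Differentiable ℝ f := hf.contDiff.differentiable (by norm_num)
  have hpd : ∀ k, partialDeriv k f = fun x => fderiv ℝ f x (EuclideanSpace.single k 1) :=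
    fun k => funext fun x => (hdf x).lineDeriv_eq_fderiv
  have hdg : ∀ k, Differentiable ℝ (partialDeriv k f) := fun k => by
    rw [hpd]
    have : ContDiff ℝ 1 (fderiv ℝ f) := hf.contDiff.fderiv_right (by norm_num)
    exact (this.differentiable (by norm_num)).clm_apply (differentiable_const _)
  set K := max C L
  have hK : 0 ≤ K := hC.le.trans (le_max_left _ _)
  have hCK : C ≤ K := le_max_left _ _
  have hLK : L ≤ K := le_max_right _ _
  have hg1 : ∀ k x, |partialDeriv k f x| ≤ C := fun k x => by
    rw [← gradient_coord (hdf x)]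
    exact (Finset.single_le_sum (f := fun k => |(∇ f x) k|) (fun i _ => abs_nonneg _)
      (Finset.mem_univ k)).trans (hb x).2.2.1
  have hg2 : ∀ k x y, |partialDeriv k f x - partialDeriv k f y| ≤ L * ‖x - y‖ := fun k x y => by
    rw [← gradient_coord (hdf x), ← gradient_coord (hdf y)]
    refine le_trans ?_ (hL x y)
    refine le_trans ?_ ((le_max_left _ _).trans (le_max_right _ _))
    exact Finset.single_le_sum (f := fun k => |(∇ f x - ∇ f y) k|) (fun i _ => abs_nonneg _)
      (Finset.mem_univ k)
  have entry : ∀ (M : Matrix (Fin d) (Fin d) ℝ) j k, |M j k| ≤ matL1 M := fun M j k =>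
    (Finset.single_le_sum (f := fun k => |M j k|) (fun i _ => abs_nonneg _)
      (Finset.mem_univ k)).trans
    (Finset.single_le_sum (f := fun j => ∑ k, |M j k|)
      (fun i _ => Finset.sum_nonneg fun _ _ => abs_nonneg _) (Finset.mem_univ j))
  have hh1 : ∀ j k x, |partialDeriv j (partialDeriv k f) x| ≤ C := fun j k x =>
    (entry (hessian f x) j k).trans (hb x).2.2.2
  have hh2 : ∀ j k x y, |partialDeriv j (partialDeriv k f) x
      - partialDeriv j (partialDeriv k f) y| ≤ L * ‖x - y‖ := fun j k x y =>
    (entry (hessian f x - hessian f y) j k).trans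
      (((le_max_right _ _).trans (le_max_right _ _)).trans (hL x y))
  have up : ∀ x y : E d, L * ‖x - y‖ ≤ K * ‖x - y‖ := fun x y => by gcongr
  obtain ⟨A, hA⟩ := exists_fourPoint hK (fun k x => (hdf x).lineDifferentiableAt)
    (fun k x => (hg1 k x).trans hCK) (fun k x y => (hg2 k x y).trans (up x y))
  have hg : ∀ k, ∃ A, FourPoint (partialDeriv k f) A := fun k =>
    exists_fourPoint hK (fun j x => (hdg k x).lineDifferentiableAt)
      (fun j x => (hh1 j k x).trans hCK) (fun j x y => (hh2 j k x y).trans (up x y))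
  choose A' hA' using hg
  have hsum : ∀ k, A' k ≤ ∑ k, A' k := fun k =>
    Finset.single_le_sum (fun i _ => (hA' i).nonneg) (Finset.mem_univ k)
  have hs0 : 0 ≤ ∑ k, A' k := Finset.sum_nonneg fun i _ => (hA' i).nonneg
  have hc' : 0 < c⁻¹ := inv_pos.2 hc
  have hA0 := hA.nonneg
  -- All terms are nonnegative, so their sum dominates every constant required.
  refine ⟨1 + c⁻¹ + C + A + ∑ k, A' k, by linarith, fun x => ?_, fun x => ?_, fun k x => ?_,
    hA.mono (by linarith), fun k => (hA' k).mono (by linarith [hsum k])⟩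
  · exact (inv_le_of_inv_le₀ hc (by linarith)).trans (hb x).1
  · linarith [(hb x).2.1]
  · exact (hg1 k x).trans (by linarith)

/-! ### Exact and Monte Carlo drifts as ratios of means -/

/-- The mean of `ψ` over the image of `μ` under `z ↦ x + s z`. -/
noncomputable def mean {d : ℕ} (ψ : E d → ℝ) (μ : Measure (E d)) (x : E d) (s : ℝ) : ℝ :=
  ∫ z, ψ (x + s • z) ∂μ

/-- The ratio of means defining both the exact and the Monte Carlo drift. -/
noncomputable def ratioDrift {d : ℕ} (f : E d → ℝ) (g : Fin d → E d → ℝ) (μ : Measure (E d))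
    (x : E d) (s : ℝ) : E d :=
  WithLp.toLp 2 fun k => mean (g k) μ x s / mean f μ x s

/-- The empirical measure of the points `z 0, …, z (N-1)`. -/
noncomputable def empirical {d N : ℕ} (z : Fin N → E d) : Measure (E d) :=
  (N : ENNReal)⁻¹ • ∑ i, Measure.dirac (z i)

section

variable {d N : ℕ}

theorem isProbabilityMeasure_empirical (hN : 1 ≤ N) (z : Fin N → E d) :
    IsProbabilityMeasure (empirical z) := by
  refine ⟨?_⟩
  have h0 : (N : ENNReal) ≠ 0 := by exact_mod_cast (by omega : N ≠ 0)
  simp [empirical, ENNReal.inv_mul_cancel h0 (ENNReal.natCast_ne_top N)]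

theorem integrable_dirac_real {z : E d} (h : E d → ℝ) : Integrable h (Measure.dirac z) :=
  integrable_dirac (by simp)

theorem integrable_empirical (z : Fin N → E d) (hN : 1 ≤ N) (h : E d → ℝ) :
    Integrable h (empirical z) := by
  have h0 : (N : ENNReal) ≠ 0 := by exact_mod_cast (by omega : N ≠ 0)
  refine Integrable.smul_measure ?_ (by simpa using h0)
  exact integrable_finsetSum_measure.2 fun i _ => integrable_dirac_real h

theorem integral_empirical (z : Fin N → E d) (h : E d → ℝ) :
    ∫ y, h y ∂(empirical z) = (1 / (N : ℝ)) * ∑ i, h (z i) := by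
  rw [empirical, integral_smul_measure,
    integral_finsetSum_measure fun i _ => integrable_dirac_real h]
  simp

theorem mean_empirical (z : Fin N → E d) (ψ : E d → ℝ) (x : E d) (s : ℝ) :
    mean ψ (empirical z) x s = (1 / (N : ℝ)) * ∑ i, ψ (x + s • z i) :=
  integral_empirical z _

theorem mcDrift_eq_ratioDrift {f : E d → ℝ} (hf : Differentiable ℝ f) (z : Fin N → E d)
    (x : E d) (t : ℝ) :
    mcDrift f z x t = ratioDrift f (fun k => partialDeriv k f) (empirical z) x √(1 - t) := by
  ext k
  simp only [mcDrift, ratioDrift, mean_empirical, PiLp.smul_apply, smul_eq_mul]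
  refine Eq.trans (congrArg₂ _ rfl (congrArg₂ _ rfl ?_)) (div_eq_inv_mul _ _).symm
  simp only [WithLp.ofLp_sum, Finset.sum_apply]
  exact Finset.sum_congr rfl fun i _ => gradient_coord (hf _) k

theorem integrable_comp_affine {μ : Measure (E d)} [IsFiniteMeasure μ] {ψ : E d → ℝ} {K : ℝ}
    (hψ : Continuous ψ) (hb : ∀ x, |ψ x| ≤ K) (x : E d) (s : ℝ) :
    Integrable (fun z => ψ (x + s • z)) μ :=
  Integrable.of_bound (by fun_prop) K (ae_of_all _ fun z => by simpa using hb _)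

theorem DriftData.abs_le {f : E d → ℝ} {g : Fin d → E d → ℝ} {κ : ℝ} (h : DriftData f g κ)
    (x : E d) : |f x| ≤ κ := by
  have : 0 ≤ κ⁻¹ := inv_nonneg.2 (zero_le_one.trans h.one_le)
  rw [abs_of_nonneg (this.trans (h.lower x))]
  exact h.upper x

/-- Differentiation under the Gaussian integral, dominated by the constant `κ` since `f` is
`κ`-Lipschitz; the logarithm then produces the quotient. -/
theorem drift_eq_ratioDrift {f : E d → ℝ} (hf : AssumptionA1 f) (x : E d) (t : ℝ) :
    drift f x t
      = ratioDrift f (fun k => partialDeriv k f) (stdGaussian (E d)) x √(1 - t) := by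
  obtain ⟨κ, hκ⟩ := hf.exists_driftData
  have h0 : 0 < κ := zero_lt_one.trans_le hκ.one_le
  have hdf : Differentiable ℝ f := hf.contDiff.differentiable (by norm_num)
  have hcf : Continuous (fderiv ℝ f) := hf.contDiff.continuous_fderiv (by norm_num)
  set s := √(1 - t)
  have hbd : ∀ y, ‖fderiv ℝ f y‖ ≤ κ := fun y =>
    norm_fderiv_le_of_lip' ℝ h0.le (Filter.Eventually.of_forall fun w => by
      simpa using hκ.fourPoint.lipschitz w y)
  have hder : HasFDerivAt (fun y => ∫ z, f (y + s • z) ∂(stdGaussian (E d)))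
      (∫ z, fderiv ℝ f (x + s • z) ∂(stdGaussian (E d))) x := by
    refine hasFDerivAt_integral_of_dominated_of_fderiv_le (bound := fun _ => κ)
      (F' := fun y z => fderiv ℝ f (y + s • z))
      (s := Set.univ) Filter.univ_mem (Filter.Eventually.of_forall fun y => ?_) ?_ ?_ ?_
      (integrable_const (μ := stdGaussian (E d)) _) ?_
    · have := hf.contDiff.continuous
      exact Continuous.aestronglyMeasurable (by fun_prop)
    · exact integrable_comp_affine (μ := stdGaussian (E d)) hf.contDiff.continuous hκ.abs_le x s
    · exact Continuous.aestronglyMeasurable (by fun_prop)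
    · exact ae_of_all _ fun z y _ => hbd _
    · refine ae_of_all _ fun z y _ => ?_
      exact (hasFDerivAt_comp_add_right (s • z)).2 (hdf (y + s • z)).hasFDerivAt
  have hint : Integrable (fun z => fderiv ℝ f (x + s • z)) (stdGaussian (E d)) :=
    Integrable.of_bound (Continuous.aestronglyMeasurable (by fun_prop)) κ
      (ae_of_all _ fun z => hbd _)
  have hpos : (∫ z, f (x + s • z) ∂(stdGaussian (E d))) ≠ 0 := by
    have : κ⁻¹ ≤ ∫ z, f (x + s • z) ∂(stdGaussian (E d)) := by
      have := integral_mono (integrable_const (μ := stdGaussian (E d)) κ⁻¹)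
        (integrable_comp_affine hf.contDiff.continuous hκ.abs_le x s) (fun z => hκ.lower _)
      simpa using this
    exact ((inv_pos.2 h0).trans_le this).ne'
  have hlog := hder.log hpos
  ext k
  rw [drift, show (fun y => Real.log (heatExpectation f y t))
    = fun y => Real.log (∫ z, f (y + s • z) ∂(stdGaussian (E d))) from rfl,
    gradient_coord hlog.differentiableAt, partialDeriv,
    hlog.differentiableAt.lineDeriv_eq_fderiv, hlog.fderiv]
  simp only [ratioDrift, mean, _root_.smul_apply, smul_eq_mul]
  rw [ContinuousLinearMap.integral_apply hint, div_eq_inv_mul]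
  congr 2
  ext z
  exact ((hdf _).lineDeriv_eq_fderiv).symm

end

/-! ### Regularity of the drift in the point, the noise level and the measure -/

variable {d : ℕ} {f : E d → ℝ} {g : Fin d → E d → ℝ} {κ : ℝ}

/-- The first absolute moment of `μ`. -/
noncomputable def absMoment {d : ℕ} (μ : Measure (E d)) : ℝ := ∫ z, ‖z‖ ∂μ

theorem absMoment_nonneg (μ : Measure (E d)) : 0 ≤ absMoment μ :=
  integral_nonneg fun _ => norm_nonneg _

/-- The deviation of the means of `f, g₁, …, g_d` under `μ` from those under `ν`. -/
noncomputable def deviation {d : ℕ} (f : E d → ℝ) (g : Fin d → E d → ℝ) (μ ν : Measure (E d))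
    (x : E d) (s : ℝ) : ℝ :=
  |mean f μ x s - mean f ν x s| + ∑ k, |mean (g k) μ x s - mean (g k) ν x s|

/-- The variation between `(x, s)` and `(x', s')` of the deviation of the means of
`f, g₁, …, g_d` under `μ` from those under `ν`. -/
noncomputable def deviationDiff {d : ℕ} (f : E d → ℝ) (g : Fin d → E d → ℝ)
    (μ ν : Measure (E d)) (x x' : E d) (s s' : ℝ) : ℝ :=
  |(mean f μ x s - mean f ν x s) - (mean f μ x' s' - mean f ν x' s')|
    + ∑ k, |(mean (g k) μ x s - mean (g k) ν x s)
      - (mean (g k) μ x' s' - mean (g k) ν x' s')|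

theorem deviation_nonneg (μ ν : Measure (E d)) (x : E d) (s : ℝ) :
    0 ≤ deviation f g μ ν x s :=
  add_nonneg (abs_nonneg _) (Finset.sum_nonneg fun _ _ => abs_nonneg _)

theorem deviationDiff_nonneg (μ ν : Measure (E d)) (x x' : E d) (s s' : ℝ) :
    0 ≤ deviationDiff f g μ ν x x' s s' :=
  add_nonneg (abs_nonneg _) (Finset.sum_nonneg fun _ _ => abs_nonneg _)

theorem norm_le_sum_abs (v : E d) : ‖v‖ ≤ ∑ k, |v k| := by
  have h : v = ∑ k, v k • (EuclideanSpace.single k 1 : E d) := by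
    ext i
    simp [Pi.single_apply]
  calc ‖v‖ = ‖∑ k, v k • (EuclideanSpace.single k 1 : E d)‖ := by rw [← h]
    _ ≤ ∑ k, ‖v k • (EuclideanSpace.single k 1 : E d)‖ := norm_sum_le _ _
    _ = ∑ k, |v k| := by simp [norm_smul]

theorem norm_le_of_forall_coord {v : E d} {c : ℝ} (h : ∀ k, |v k| ≤ c) : ‖v‖ ≤ d * c := by
  refine (norm_le_sum_abs v).trans ?_
  simpa using Finset.sum_le_sum fun k (_ : k ∈ Finset.univ) => h k

section Mean

variable {ψ : E d → ℝ} {A K : ℝ} {μ : Measure (E d)} [IsProbabilityMeasure μ]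

theorem abs_mean_le (hb : ∀ x, |ψ x| ≤ K) (x : E d) (s : ℝ) : |mean ψ μ x s| ≤ K := by
  simpa [mean] using norm_integral_le_of_norm_le_const (μ := μ) (C := K)
    (f := fun z => ψ (x + s • z)) (ae_of_all _ fun z => by simpa using hb _)

theorem abs_mean_sub_le (h : FourPoint ψ A) (hb : ∀ x, |ψ x| ≤ K)
    (hμ : Integrable (fun z => ‖z‖) μ) (x x' : E d) (s s' : ℝ) :
    |mean ψ μ x s - mean ψ μ x' s'| ≤ A * (‖x - x'‖ + |s - s'| * absMoment μ) := by
  rw [mean, mean, ← integral_sub (integrable_comp_affine h.continuous hb x s)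
    (integrable_comp_affine h.continuous hb x' s')]
  have hi : Integrable (fun z => A * (‖x - x'‖ + |s - s'| * ‖z‖)) μ :=
    ((integrable_const _).add (hμ.const_mul _)).const_mul _
  rw [← Real.norm_eq_abs]
  refine (norm_integral_le_of_norm_le hi (ae_of_all _ fun z => ?_)).trans_eq ?_
  · refine (h.lipschitz _ _).trans (mul_le_mul_of_nonneg_left ?_ h.nonneg)
    have : x + s • z - (x' + s' • z) = (x - x') + (s - s') • z := by rw [sub_smul]; abel
    rw [this]
    refine (norm_add_le _ _).trans_eq ?_
    rw [norm_smul, Real.norm_eq_abs]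
  · rw [integral_const_mul, integral_add (integrable_const _) (hμ.const_mul _),
      integral_const_mul]
    simp [absMoment]

/-- The pointwise estimate is integrated in `z`. As `y, x` share the level `s` and `y', x'` share
`s'`, the variable `z` cancels from the second difference of the arguments and from `y - x`, `y' -
x'`; it survives only in the last factor, to first order. -/
theorem abs_mean_four_point_le (h : FourPoint ψ A) (hb : ∀ x, |ψ x| ≤ K)
    (hμ : Integrable (fun z => ‖z‖) μ) (y y' x x' : E d) (s s' : ℝ) :
    |mean ψ μ y s - mean ψ μ y' s' - mean ψ μ x s + mean ψ μ x' s'|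
      ≤ A * (‖y - y' - x + x'‖
        + (‖y - x‖ + ‖y' - x'‖) * (‖x - x'‖ + |s - s'| * absMoment μ)) := by
  have hI : ∀ x s, Integrable (fun z => ψ (x + s • z)) μ :=
    fun x s => integrable_comp_affine h.continuous hb x s
  have hmean : mean ψ μ y s - mean ψ μ y' s' - mean ψ μ x s + mean ψ μ x' s'
      = ∫ z, (ψ (y + s • z) - ψ (y' + s' • z) - ψ (x + s • z) + ψ (x' + s' • z)) ∂μ := by
    have i1 : Integrable (fun z => ψ (y + s • z) - ψ (y' + s' • z)) μ :=
      (hI y s).sub (hI y' s')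
    have i2 : Integrable (fun z => ψ (y + s • z) - ψ (y' + s' • z) - ψ (x + s • z)) μ :=
      i1.sub (hI x s)
    rw [integral_add i2 (hI x' s'), integral_sub i1 (hI x s),
      integral_sub (hI y s) (hI y' s')]
    rfl
  rw [hmean]
  have hi0 : Integrable (fun z => (‖y - x‖ + ‖y' - x'‖) * (‖x - x'‖ + |s - s'| * ‖z‖)) μ :=
    ((integrable_const _).add (hμ.const_mul _)).const_mul _
  have hi : Integrable (fun z => A * (‖y - y' - x + x'‖
      + (‖y - x‖ + ‖y' - x'‖) * (‖x - x'‖ + |s - s'| * ‖z‖))) μ :=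
    ((integrable_const _).add hi0).const_mul _
  rw [← Real.norm_eq_abs]
  refine (norm_integral_le_of_norm_le hi (ae_of_all _ fun z => ?_)).trans_eq ?_
  · refine (h.bound _ _ _ _).trans (mul_le_mul_of_nonneg_left ?_ h.nonneg)
    have e1 : y + s • z - (y' + s' • z) - (x + s • z) + (x' + s' • z) = y - y' - x + x' := by
      abel
    have e2 : x + s • z - (x' + s' • z) = (x - x') + (s - s') • z := by rw [sub_smul]; abel
    rw [e1, e2, add_sub_add_right_eq_sub, add_sub_add_right_eq_sub]
    have : ‖(x - x') + (s - s') • z‖ ≤ ‖x - x'‖ + |s - s'| * ‖z‖ := by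
      refine (norm_add_le _ _).trans_eq ?_
      rw [norm_smul, Real.norm_eq_abs]
    gcongr
  · rw [integral_const_mul, integral_add (integrable_const _) hi0, integral_const_mul,
      integral_add (integrable_const _) (hμ.const_mul _), integral_const_mul]
    simp [absMoment]

theorem DriftData.inv_le_mean (h : DriftData f g κ) (x : E d) (s : ℝ) :
    κ⁻¹ ≤ mean f μ x s := by
  have := integral_mono (integrable_const (μ := μ) κ⁻¹)
    (integrable_comp_affine h.fourPoint.continuous h.abs_le x s) (fun z => h.lower _)
  simpa [mean] using this

end Mean

/-- Lipschitz bound for quotients with denominators bounded away from zero. -/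
theorem abs_div_sub_div_le (hκ : 1 ≤ κ) {a a' v v' : ℝ} (ha : κ⁻¹ ≤ a) (ha' : κ⁻¹ ≤ a')
    (hv' : |v'| ≤ κ) : |v / a - v' / a'| ≤ κ ^ 3 * (|v - v'| + |a - a'|) := by
  have h0 : 0 < κ := zero_lt_one.trans_le hκ
  have hi : 0 < κ⁻¹ := inv_pos.2 h0
  have pa : 0 < a := hi.trans_le ha
  have pa' : 0 < a' := hi.trans_le ha'
  have ia : a⁻¹ ≤ κ := inv_le_of_inv_le₀ h0 ha
  have ia' : a'⁻¹ ≤ κ := inv_le_of_inv_le₀ h0 ha'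
  have e : v / a - v' / a' = a⁻¹ * (v - v') - v' * (a⁻¹ * a'⁻¹ * (a - a')) := by
    field_simp
    ring
  have qa : 0 < a⁻¹ := inv_pos.2 pa
  have qa' : 0 < a'⁻¹ := inv_pos.2 pa'
  rw [e]
  calc |a⁻¹ * (v - v') - v' * (a⁻¹ * a'⁻¹ * (a - a'))|
      ≤ a⁻¹ * |v - v'| + |v'| * (a⁻¹ * a'⁻¹ * |a - a'|) := by
        refine (abs_sub _ _).trans_eq ?_
        simp only [abs_mul, abs_of_pos qa, abs_of_pos qa']
    _ ≤ κ * |v - v'| + κ * (κ * κ * |a - a'|) := by gcongr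
    _ ≤ κ ^ 3 * |v - v'| + κ ^ 3 * |a - a'| := by
        have : κ ≤ κ ^ 3 := le_self_pow₀ hκ (by norm_num)
        have := mul_le_mul_of_nonneg_right this (abs_nonneg (v - v'))
        linarith [show κ * (κ * κ * |a - a'|) = κ ^ 3 * |a - a'| by ring]
    _ = _ := by ring

/-- Four-point bound for quotients with denominators bounded away from zero. -/
theorem abs_div_four_point_le (hκ : 1 ≤ κ) {a₁ a₂ a₃ a₄ v₁ v₂ v₃ v₄ : ℝ}
    (h₁ : κ⁻¹ ≤ a₁) (h₂ : κ⁻¹ ≤ a₂) (h₃ : κ⁻¹ ≤ a₃) (h₄ : κ⁻¹ ≤ a₄) (hv : |v₂| ≤ κ) :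
    |v₁ / a₁ - v₂ / a₂ - v₃ / a₃ + v₄ / a₄| ≤ κ ^ 4 * (|v₁ - v₂ - v₃ + v₄|
      + |a₁ - a₂ - a₃ + a₄|
      + (|a₁ - a₃| + |a₂ - a₄| + |v₂ - v₄|) * (|a₃ - a₄| + |v₃ - v₄|)) := by
  have h0 : 0 < κ := zero_lt_one.trans_le hκ
  have hi : 0 < κ⁻¹ := inv_pos.2 h0
  have p₁ := hi.trans_le h₁
  have p₂ := hi.trans_le h₂
  have p₃ := hi.trans_le h₃
  have p₄ := hi.trans_le h₄
  have i₁ : a₁⁻¹ ≤ κ := inv_le_of_inv_le₀ h0 h₁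
  have i₂ : a₂⁻¹ ≤ κ := inv_le_of_inv_le₀ h0 h₂
  have i₃ : a₃⁻¹ ≤ κ := inv_le_of_inv_le₀ h0 h₃
  have i₄ : a₄⁻¹ ≤ κ := inv_le_of_inv_le₀ h0 h₄
  have q₁ : 0 < a₁⁻¹ := inv_pos.2 p₁
  have q₂ : 0 < a₂⁻¹ := inv_pos.2 p₂
  have q₃ : 0 < a₃⁻¹ := inv_pos.2 p₃
  have q₄ : 0 < a₄⁻¹ := inv_pos.2 p₄
  set S := a₁ - a₂ - a₃ + a₄ with hS
  set T := v₁ - v₂ - v₃ + v₄ with hT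
  -- Besides `T` and `S`, each summand pairs a difference across (1,3) or (2,4) with one across
  -- (3,4), the product form the estimate requires.
  have e : v₁ / a₁ - v₂ / a₂ - v₃ / a₃ + v₄ / a₄
      = a₁⁻¹ * T - v₂ * (a₂⁻¹ * a₁⁻¹ * S) + v₂ * (a₂⁻¹ * a₃⁻¹ * a₄⁻¹ * (a₃ - a₄) * (a₂ - a₄))
        + v₂ * (a₂⁻¹ * a₁⁻¹ * a₃⁻¹ * (a₁ - a₃) * (a₃ - a₄))
        - a₃⁻¹ * a₄⁻¹ * (a₃ - a₄) * (v₂ - v₄) - a₁⁻¹ * a₃⁻¹ * (a₁ - a₃) * (v₃ - v₄) := by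
    rw [hS, hT]
    field_simp
    ring
  rw [e]
  have b : |a₁⁻¹ * T - v₂ * (a₂⁻¹ * a₁⁻¹ * S)
        + v₂ * (a₂⁻¹ * a₃⁻¹ * a₄⁻¹ * (a₃ - a₄) * (a₂ - a₄))
        + v₂ * (a₂⁻¹ * a₁⁻¹ * a₃⁻¹ * (a₁ - a₃) * (a₃ - a₄))
        - a₃⁻¹ * a₄⁻¹ * (a₃ - a₄) * (v₂ - v₄) - a₁⁻¹ * a₃⁻¹ * (a₁ - a₃) * (v₃ - v₄)|
      ≤ κ * |T| + κ * (κ * κ * |S|) + κ * (κ * κ * κ * |a₃ - a₄| * |a₂ - a₄|)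
        + κ * (κ * κ * κ * |a₁ - a₃| * |a₃ - a₄|)
        + κ * κ * |a₃ - a₄| * |v₂ - v₄| + κ * κ * |a₁ - a₃| * |v₃ - v₄| := by
    refine (abs_sub _ _).trans (add_le_add ((abs_sub _ _).trans (add_le_add
      ((abs_add_le _ _).trans (add_le_add ((abs_add_le _ _).trans (add_le_add
      ((abs_sub _ _).trans (add_le_add ?_ ?_)) ?_)) ?_)) ?_)) ?_) <;>
    · simp only [abs_mul, abs_of_pos q₁, abs_of_pos q₂, abs_of_pos q₃, abs_of_pos q₄]
      gcongr
  refine b.trans ?_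
  have k1 : κ ≤ κ ^ 4 := le_self_pow₀ hκ (by norm_num)
  have k2 : κ ^ 2 ≤ κ ^ 4 := pow_le_pow_right₀ hκ (by norm_num)
  have k3 : κ ^ 3 ≤ κ ^ 4 := pow_le_pow_right₀ hκ (by norm_num)
  have m1 := mul_le_mul_of_nonneg_right k1 (abs_nonneg T)
  have m2 := mul_le_mul_of_nonneg_right k3 (abs_nonneg S)
  have m3 := mul_le_mul_of_nonneg_right k2
    (mul_nonneg (abs_nonneg (a₃ - a₄)) (abs_nonneg (v₂ - v₄)))
  have m4 := mul_le_mul_of_nonneg_right k2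
    (mul_nonneg (abs_nonneg (a₁ - a₃)) (abs_nonneg (v₃ - v₄)))
  have m5 : 0 ≤ κ ^ 4 * (|a₂ - a₄| * |v₃ - v₄|) := by positivity
  have m6 : 0 ≤ κ ^ 4 * (|v₂ - v₄| * |v₃ - v₄|) := by positivity
  nlinarith

/-- The common constant in the regularity estimates for `ratioDrift`. -/
noncomputable def driftConst (d : ℕ) (κ M : ℝ) : ℝ := 8 * (d + 1) * κ ^ 6 * M

/-- The factor `d + 1`, rather than the `d` of the coordinatewise bound, keeps the constant positive
for `d = 0`. -/
theorem driftConst_pos (hκ : 1 ≤ κ) {M : ℝ} (hM : 1 ≤ M) : 0 < driftConst d κ M := by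
  unfold driftConst; positivity

/-- Absorbs the numerical factor of a coordinatewise bound into `driftConst`. -/
theorem mul_le_driftConst (hκ : 1 ≤ κ) {M : ℝ} (hM : 1 ≤ M) {a b : ℝ} (ha : a ≤ 8 * κ ^ 6 * M)
    (hb : 0 ≤ b) : d * (a * b) ≤ driftConst d κ M * b := by
  have : (0 : ℝ) ≤ d := Nat.cast_nonneg d
  have h8 : 0 ≤ 8 * κ ^ 6 * M := by positivity
  have h1 : a * b ≤ 8 * κ ^ 6 * M * b := by gcongr
  unfold driftConst
  nlinarith [mul_le_mul_of_nonneg_left h1 this, mul_nonneg h8 hb]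

theorem DriftData.norm_ratioDrift_le (h : DriftData f g κ) {M : ℝ} (hM : 1 ≤ M)
    (μ : Measure (E d)) [IsProbabilityMeasure μ] (x : E d) (s : ℝ) :
    ‖ratioDrift f g μ x s‖ ≤ driftConst d κ M := by
  have hκ := h.one_le
  have h0 : 0 < κ := zero_lt_one.trans_le hκ
  refine (norm_le_of_forall_coord (c := κ ^ 2 * 1) fun k => ?_).trans
    ((mul_le_driftConst hκ hM ?_ zero_le_one).trans_eq (mul_one _))
  · have hm : κ⁻¹ ≤ mean f μ x s := h.inv_le_mean x s
    have pm : 0 < mean f μ x s := (inv_pos.2 h0).trans_le hm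
    have hi : (mean f μ x s)⁻¹ ≤ κ := inv_le_of_inv_le₀ h0 hm
    simp only [ratioDrift]
    rw [div_eq_mul_inv, abs_mul, abs_of_pos (inv_pos.2 pm), mul_one, sq]
    have := abs_mean_le (μ := μ) (h.bound k) x s
    gcongr
  · have : κ ^ 2 ≤ κ ^ 6 := pow_le_pow_right₀ hκ (by norm_num)
    have h6 : 0 < κ ^ 6 := by positivity
    nlinarith

theorem DriftData.norm_ratioDrift_sub_le (h : DriftData f g κ) {M : ℝ} (hM : 1 ≤ M)
    (μ : Measure (E d)) [IsProbabilityMeasure μ] (hμ : Integrable (fun z => ‖z‖) μ)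
    (x x' : E d) (s s' : ℝ) :
    ‖ratioDrift f g μ x s - ratioDrift f g μ x' s'‖
      ≤ driftConst d κ M * (‖x - x'‖ + |s - s'| * absMoment μ) := by
  have hκ := h.one_le
  have h0 : 0 < κ := zero_lt_one.trans_le hκ
  have hm0 := absMoment_nonneg μ
  refine (norm_le_of_forall_coord
    (c := 2 * κ ^ 4 * (‖x - x'‖ + |s - s'| * absMoment μ)) fun k => ?_).trans
    (mul_le_driftConst hκ hM ?_ (by positivity))
  · simp only [ratioDrift, PiLp.sub_apply]
    refine (abs_div_sub_div_le hκ (h.inv_le_mean x s) (h.inv_le_mean x' s')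
      (abs_mean_le (h.bound k) x' s')).trans ?_
    have h1 := abs_mean_sub_le h.fourPoint h.abs_le hμ x x' s s'
    have h2 := abs_mean_sub_le (h.fourPoint_g k) (h.bound k) hμ x x' s s'
    refine (mul_le_mul_of_nonneg_left (add_le_add h2 h1) (by positivity)).trans_eq ?_
    ring
  · have : κ ^ 4 ≤ κ ^ 6 := pow_le_pow_right₀ hκ (by norm_num)
    have h6 : 0 < κ ^ 6 := by positivity
    nlinarith

theorem abs_le_deviation (μ ν : Measure (E d)) (x : E d) (s : ℝ) (k : Fin d) :
    |mean f μ x s - mean f ν x s| + |mean (g k) μ x s - mean (g k) ν x s|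
      ≤ deviation f g μ ν x s :=
  add_le_add_right (Finset.single_le_sum
    (f := fun k => |mean (g k) μ x s - mean (g k) ν x s|)
    (fun _ _ => abs_nonneg _) (Finset.mem_univ k)) _

theorem abs_le_deviationDiff (μ ν : Measure (E d)) (x x' : E d) (s s' : ℝ) (k : Fin d) :
    |(mean f μ x s - mean f ν x s) - (mean f μ x' s' - mean f ν x' s')|
      + |(mean (g k) μ x s - mean (g k) ν x s) - (mean (g k) μ x' s' - mean (g k) ν x' s')|
      ≤ deviationDiff f g μ ν x x' s s' :=
  add_le_add_right (Finset.single_le_sum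
    (f := fun k => |(mean (g k) μ x s - mean (g k) ν x s)
      - (mean (g k) μ x' s' - mean (g k) ν x' s')|)
    (fun _ _ => abs_nonneg _) (Finset.mem_univ k)) _

theorem DriftData.norm_ratioDrift_sub_le_deviation (h : DriftData f g κ) {M : ℝ} (hM : 1 ≤ M)
    (μ ν : Measure (E d)) [IsProbabilityMeasure μ] [IsProbabilityMeasure ν]
    (x : E d) (s : ℝ) :
    ‖ratioDrift f g μ x s - ratioDrift f g ν x s‖
      ≤ driftConst d κ M * deviation f g μ ν x s := by
  have hκ := h.one_le
  have h0 : 0 < κ := zero_lt_one.trans_le hκ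
  refine (norm_le_of_forall_coord (c := κ ^ 3 * deviation f g μ ν x s) fun k => ?_).trans
    (mul_le_driftConst hκ hM ?_ (deviation_nonneg _ _ _ _))
  · simp only [ratioDrift, PiLp.sub_apply]
    refine (abs_div_sub_div_le hκ (h.inv_le_mean x s) (h.inv_le_mean x s)
      (abs_mean_le (h.bound k) x s)).trans ?_
    gcongr
    rw [add_comm]
    exact abs_le_deviation μ ν x s k
  · have : κ ^ 3 ≤ κ ^ 6 := pow_le_pow_right₀ hκ (by norm_num)
    have h6 : 0 < κ ^ 6 := by positivity
    nlinarith

/-- The left side is what `abs_div_four_point_le` becomes once the bounds on means are inserted. Its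
largest product, `κ⁴ · 2κU · 2κMH`, explains the power `κ⁶`; `U * H` is absorbed by `U * (1 + m) *
H`. -/
theorem four_point_constant_le (hκ : 1 ≤ κ) {M D U H m θ η : ℝ} (hM : 1 ≤ M) (hD : 0 ≤ D)
    (hU : 0 ≤ U) (hH : 0 ≤ H) (hm : 0 ≤ m) (hθ : 0 ≤ θ) (hη : 0 ≤ η) :
    κ ^ 4 * (2 * κ * (D + U * (1 + m) * H) + θ + (2 * κ * U + η) * (2 * (κ * M * H)))
      ≤ 8 * κ ^ 6 * M * (D + U * (1 + m) * H + θ + η * H) := by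
  have h0 : 0 < κ := zero_lt_one.trans_le hκ
  have zM : 0 ≤ M := by linarith
  set W := U * (1 + m) * H with hW
  have hW0 : 0 ≤ W := by positivity
  have hUW : U * H ≤ W := by
    rw [hW, mul_right_comm]
    exact le_mul_of_one_le_right (by positivity) (by linarith)
  have k2 : κ ≤ κ ^ 2 := le_self_pow₀ hκ (by norm_num)
  have k1 : 1 ≤ κ ^ 2 := one_le_pow₀ hκ
  have k3 : κ ≤ κ ^ 2 * M := k2.trans (le_mul_of_one_le_right (by positivity) hM)
  have k4 : 1 ≤ κ ^ 2 * M := hκ.trans k3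
  have k5 : κ * M ≤ κ ^ 2 * M := by gcongr
  have m1 := mul_le_mul_of_nonneg_right k3 (add_nonneg hD hW0)
  have m2 := mul_le_mul_of_nonneg_right k4 hθ
  have m3 := mul_le_mul_of_nonneg_left hUW (show 0 ≤ κ ^ 2 * M by positivity)
  have m4 := mul_le_mul_of_nonneg_right k5 (mul_nonneg hη hH)
  have z1 : 0 ≤ κ ^ 2 * M * D := by positivity
  have z2 : 0 ≤ κ ^ 2 * M * θ := by positivity
  have z3 : 0 ≤ κ ^ 2 * M * (η * H) := by positivity
  have z4 : 0 ≤ κ ^ 2 * M * W := by positivity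
  have e2 : 8 * κ ^ 6 * M * (D + W + θ + η * H)
      = κ ^ 4 * (8 * (κ ^ 2 * M * D) + 8 * (κ ^ 2 * M * W) + 8 * (κ ^ 2 * M * θ)
        + 8 * (κ ^ 2 * M * (η * H))) := by ring
  rw [e2]
  refine mul_le_mul_of_nonneg_left ?_ (by positivity)
  have e1 : (2 * κ * U + η) * (2 * (κ * M * H))
      = 4 * (κ ^ 2 * M * (U * H)) + 2 * (κ * M * (η * H)) := by ring
  rw [e1]
  linarith

/-- The second difference of two drifts, driven by the second difference of the points, by the
product of the two first differences, and by the deviation of `μ` from `ν`. -/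
theorem DriftData.norm_ratioDrift_four_point_le (h : DriftData f g κ) {M : ℝ} (hM : 1 ≤ M)
    (μ ν : Measure (E d)) [IsProbabilityMeasure μ] [IsProbabilityMeasure ν]
    (hμ : Integrable (fun z => ‖z‖) μ) (hν : Integrable (fun z => ‖z‖) ν)
    (hνM : absMoment ν ≤ M) (y y' x x' : E d) (s s' : ℝ) :
    ‖ratioDrift f g μ y s - ratioDrift f g μ y' s' - ratioDrift f g ν x s
        + ratioDrift f g ν x' s'‖
      ≤ driftConst d κ M * (‖y - y' - x + x'‖
        + (‖y - x‖ + ‖y' - x'‖) * (1 + absMoment μ) * (‖x - x'‖ + |s - s'|)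
        + deviationDiff f g μ ν x x' s s'
        + (deviation f g μ ν x s + deviation f g μ ν x' s') * (‖x - x'‖ + |s - s'|)) := by
  have hκ := h.one_le
  have h0 : 0 < κ := zero_lt_one.trans_le hκ
  have hm0 := absMoment_nonneg μ
  have hθ0 := deviationDiff_nonneg (f := f) (g := g) μ ν x x' s s'
  have hη0 := deviation_nonneg (f := f) (g := g) μ ν x s
  have hη0' := deviation_nonneg (f := f) (g := g) μ ν x' s'
  refine (norm_le_of_forall_coord (fun k => ?_)).trans
    (mul_le_driftConst (a := 8 * κ ^ 6 * M) hκ hM le_rfl (by positivity))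
  simp only [ratioDrift, PiLp.sub_apply, PiLp.add_apply]
  refine (abs_div_four_point_le hκ (h.inv_le_mean y s) (h.inv_le_mean y' s')
      (h.inv_le_mean x s) (h.inv_le_mean x' s') (abs_mean_le (h.bound k) y' s')).trans ?_
  have dd : ∀ ψ : E d → ℝ, FourPoint ψ κ → (∀ x, |ψ x| ≤ κ) →
      |mean ψ μ y s - mean ψ μ y' s' - mean ψ ν x s + mean ψ ν x' s'|
        ≤ κ * (‖y - y' - x + x'‖
          + (‖y - x‖ + ‖y' - x'‖) * (1 + absMoment μ) * (‖x - x'‖ + |s - s'|))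
          + |(mean ψ μ x s - mean ψ ν x s) - (mean ψ μ x' s' - mean ψ ν x' s')| := by
    intro ψ h4 hb
    have e : mean ψ μ y s - mean ψ μ y' s' - mean ψ ν x s + mean ψ ν x' s'
        = (mean ψ μ y s - mean ψ μ y' s' - mean ψ μ x s + mean ψ μ x' s')
          + ((mean ψ μ x s - mean ψ ν x s) - (mean ψ μ x' s' - mean ψ ν x' s')) := by ring
    rw [e]
    refine (abs_add_le _ _).trans (add_le_add_left
      ((abs_mean_four_point_le h4 hb hμ y y' x x' s s').trans ?_) _)
    rw [mul_assoc (‖y - x‖ + ‖y' - x'‖)]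
    gcongr
    nlinarith [norm_nonneg (x - x'), abs_nonneg (s - s'),
      mul_nonneg hm0 (norm_nonneg (x - x'))]
  have first : ∀ ψ : E d → ℝ, FourPoint ψ κ → (∀ x, |ψ x| ≤ κ) → ∀ (y x : E d) (s : ℝ),
      |mean ψ μ y s - mean ψ ν x s| ≤ κ * ‖y - x‖ + |mean ψ μ x s - mean ψ ν x s| := by
    intro ψ h4 hb y x s
    refine (abs_sub_le _ (mean ψ μ x s) _).trans (add_le_add_left ?_ _)
    simpa using abs_mean_sub_le h4 hb hμ y x s s
  have second : ∀ ψ : E d → ℝ, FourPoint ψ κ → (∀ x, |ψ x| ≤ κ) →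
      |mean ψ ν x s - mean ψ ν x' s'| ≤ κ * M * (‖x - x'‖ + |s - s'|) := by
    intro ψ h4 hb
    refine (abs_mean_sub_le h4 hb hν x x' s s').trans ?_
    rw [mul_assoc]
    gcongr
    nlinarith [norm_nonneg (x - x'), abs_nonneg (s - s'),
      mul_le_mul_of_nonneg_left hνM (abs_nonneg (s - s')),
      mul_le_mul_of_nonneg_right hM (norm_nonneg (x - x'))]
  have t1 := dd f h.fourPoint h.abs_le
  have t2 := dd (g k) (h.fourPoint_g k) (h.bound k)
  have t3 := first f h.fourPoint h.abs_le y x s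
  have t4 := first f h.fourPoint h.abs_le y' x' s'
  have t5 := first (g k) (h.fourPoint_g k) (h.bound k) y' x' s'
  have t6 := second f h.fourPoint h.abs_le
  have t7 := second (g k) (h.fourPoint_g k) (h.bound k)
  have t8 := abs_le_deviationDiff (f := f) (g := g) μ ν x x' s s' k
  have t9 := abs_le_deviation (f := f) (g := g) μ ν x s k
  have t10 := abs_le_deviation (f := f) (g := g) μ ν x' s' k
  have t11 := abs_nonneg (mean (g k) μ x s - mean (g k) ν x s)
  set D := ‖y - y' - x + x'‖
  set U := ‖y - x‖
  set V := ‖y' - x'‖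
  set H := ‖x - x'‖ + |s - s'|
  set θ := deviationDiff f g μ ν x x' s s'
  set η := deviation f g μ ν x s
  set η' := deviation f g μ ν x' s'
  have hD0 : 0 ≤ D := norm_nonneg _
  have hU0 : 0 ≤ U := norm_nonneg _
  have hV0 : 0 ≤ V := norm_nonneg _
  have hH0 : 0 ≤ H := by positivity
  have s1 : |mean f μ y s - mean f ν x s| + |mean f μ y' s' - mean f ν x' s'|
      + |mean (g k) μ y' s' - mean (g k) ν x' s'| ≤ 2 * κ * (U + V) + (η + η') := by
    linarith [mul_nonneg h0.le hU0]
  have s2 : |mean f ν x s - mean f ν x' s'| + |mean (g k) ν x s - mean (g k) ν x' s'|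
      ≤ 2 * (κ * M * H) := by linarith
  have s3 : |mean (g k) μ y s - mean (g k) μ y' s' - mean (g k) ν x s + mean (g k) ν x' s'|
      + |mean f μ y s - mean f μ y' s' - mean f ν x s + mean f ν x' s'|
      ≤ 2 * κ * (D + (U + V) * (1 + absMoment μ) * H) + θ := by linarith
  exact (mul_le_mul_of_nonneg_left (add_le_add s3 (mul_le_mul s1 s2 (by positivity)
    (by positivity))) (by positivity)).trans (four_point_constant_le hκ hM hD0
    (by positivity) hH0 hm0 hθ0 (add_nonneg hη0 hη0'))

/-! ### A calculus of `L²` bounds -/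

/-- `F` is dominated by a measurable function whose `L²(μ)`-norm is at most `c`. -/
def L2Le {α : Type*} [MeasurableSpace α] (μ : Measure α) (F : α → ℝ) (c : ℝ) : Prop :=
  0 ≤ c ∧ ∃ G : α → ℝ, AEStronglyMeasurable G μ ∧ (∀ x, |F x| ≤ G x) ∧
    eLpNorm G 2 μ ≤ ENNReal.ofReal c

namespace L2Le

variable {α : Type*} [MeasurableSpace α] {μ : Measure α} {F G : α → ℝ} {a b : ℝ}

/-- Asking only for a measurable dominating function frees such comparisons from any measurability
of `F`. -/
theorem mono (h : L2Le μ G a) (hFG : ∀ x, |F x| ≤ |G x|) : L2Le μ F a := by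
  obtain ⟨h0, H, hH, hGH, hle⟩ := h
  exact ⟨h0, H, hH, fun x => (hFG x).trans (hGH x), hle⟩

theorem of_le (h : L2Le μ G a) (h0 : ∀ x, 0 ≤ F x) (hFG : ∀ x, F x ≤ G x) : L2Le μ F a :=
  h.mono fun x => by rw [abs_of_nonneg (h0 x)]; exact (hFG x).trans (le_abs_self _)

theorem mono_const (h : L2Le μ F a) (hab : a ≤ b) : L2Le μ F b := by
  obtain ⟨h0, H, hH, hGH, hle⟩ := h
  exact ⟨h0.trans hab, H, hH, hGH, hle.trans (ENNReal.ofReal_le_ofReal hab)⟩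

theorem add (hF : L2Le μ F a) (hG : L2Le μ G b) : L2Le μ (fun x => F x + G x) (a + b) := by
  obtain ⟨h0, H, hH, hFH, hle⟩ := hF
  obtain ⟨h0', H', hH', hGH', hle'⟩ := hG
  refine ⟨add_nonneg h0 h0', H + H', hH.add hH', fun x =>
    (abs_add_le _ _).trans (add_le_add (hFH x) (hGH' x)), ?_⟩
  rw [ENNReal.ofReal_add h0 h0']
  exact (eLpNorm_add_le hH hH' (by norm_num)).trans (add_le_add hle hle')

theorem const_mul (hF : L2Le μ F a) {r : ℝ} (hr : 0 ≤ r) :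
    L2Le μ (fun x => r * F x) (r * a) := by
  obtain ⟨h0, H, hH, hFH, hle⟩ := hF
  refine ⟨mul_nonneg hr h0, r • H, hH.const_smul r, fun x => ?_, ?_⟩
  · rw [abs_mul, abs_of_nonneg hr]
    exact mul_le_mul_of_nonneg_left (hFH x) hr
  · rw [eLpNorm_const_smul, ENNReal.ofReal_mul hr, Real.enorm_eq_ofReal hr]
    gcongr

theorem mul_const (hF : L2Le μ F a) {r : ℝ} (hr : 0 ≤ r) :
    L2Le μ (fun x => F x * r) (a * r) := by
  simpa only [mul_comm _ r] using hF.const_mul hr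

theorem const [IsProbabilityMeasure μ] {r : ℝ} (hr : 0 ≤ r) : L2Le μ (fun _ => r) r := by
  refine ⟨hr, fun _ => r, aestronglyMeasurable_const, fun _ => (abs_of_nonneg hr).le, ?_⟩
  rw [eLpNorm_const r (by norm_num) (IsProbabilityMeasure.ne_zero μ)]
  simp [Real.enorm_eq_ofReal hr]

theorem sum {ι : Type*} (s : Finset ι) {F : ι → α → ℝ} {a : ι → ℝ}
    (h : ∀ i ∈ s, L2Le μ (F i) (a i)) : L2Le μ (fun x => ∑ i ∈ s, F i x) (∑ i ∈ s, a i) := by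
  classical
  induction s using Finset.induction_on with
  | empty => exact ⟨by simp, 0, aestronglyMeasurable_zero, fun x => by simp, by simp⟩
  | insert i s hi ih =>
    simp only [Finset.sum_insert hi]
    exact (h i (by simp)).add (ih fun j hj => h j (by simp [hj]))

theorem eLpNorm_two_sq (F : α → ℝ) : eLpNorm F 2 μ ^ 2 = ∫⁻ x, ‖F x‖ₑ ^ 2 ∂μ := by
  have := eLpNorm_nnreal_pow_eq_lintegral (f := F) (μ := μ) (p := 2) (by norm_num)
  simpa only [NNReal.coe_ofNat, ENNReal.coe_ofNat, ENNReal.rpow_ofNat] using this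

theorem of_integral (hF : MemLp F 2 μ) (ha : 0 ≤ a) (h : ∫ x, F x ^ 2 ∂μ ≤ a ^ 2) :
    L2Le μ F a := by
  refine ⟨ha, fun x => |F x|, hF.1.norm, fun x => le_rfl, ?_⟩
  have e : eLpNorm (fun x => |F x|) 2 μ = eLpNorm F 2 μ := eLpNorm_norm F
  rw [e, ← ENNReal.pow_le_pow_left_iff (n := 2) (by norm_num), eLpNorm_two_sq,
    ← ENNReal.ofReal_pow ha]
  refine le_trans (le_of_eq ?_) (ENNReal.ofReal_le_ofReal h)
  rw [ofReal_integral_eq_lintegral_ofReal hF.integrable_sq (ae_of_all _ fun x => sq_nonneg _)]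
  refine lintegral_congr fun x => ?_
  rw [← Real.enorm_eq_ofReal (sq_nonneg _), enorm_pow]

theorem lintegral_le (h : L2Le μ F a) : ∫⁻ x, ‖F x‖ₑ ^ 2 ∂μ ≤ ENNReal.ofReal a ^ 2 := by
  obtain ⟨h0, H, hH, hFH, hle⟩ := h
  calc ∫⁻ x, ‖F x‖ₑ ^ 2 ∂μ ≤ ∫⁻ x, ‖H x‖ₑ ^ 2 ∂μ := by
        refine lintegral_mono fun x => ?_
        have : ‖F x‖ₑ ≤ ‖H x‖ₑ := by
          rw [enorm_le_iff_norm_le]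
          exact (hFH x).trans (le_abs_self _)
        gcongr
    _ = eLpNorm H 2 μ ^ 2 := (eLpNorm_two_sq H).symm
    _ ≤ _ := by gcongr

theorem memLp (hF : AEStronglyMeasurable F μ) (h : L2Le μ F a) : MemLp F 2 μ := by
  obtain ⟨h0, H, hH, hFH, hle⟩ := h
  have : MemLp H 2 μ := ⟨hH, hle.trans_lt ENNReal.ofReal_lt_top⟩
  exact this.mono' hF (ae_of_all _ hFH)

theorem integral_le (hF : AEStronglyMeasurable F μ) (h : L2Le μ F a) :
    ∫ x, F x ^ 2 ∂μ ≤ a ^ 2 := by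
  have hm := h.memLp hF
  rw [← ENNReal.ofReal_le_ofReal_iff (sq_nonneg a), ENNReal.ofReal_pow h.1,
    ofReal_integral_eq_lintegral_ofReal hm.integrable_sq (ae_of_all _ fun x => sq_nonneg _)]
  refine le_trans (le_of_eq (lintegral_congr fun x => ?_)) h.lintegral_le
  rw [← Real.enorm_eq_ofReal (sq_nonneg _), enorm_pow]

/-- Discrete Grönwall inequality in `L²`. -/
theorem gronwall {F : ℕ → α → ℝ} {r : ℕ → ℝ} {L : ℝ} (hL : 0 ≤ L) (hr : ∀ k, 0 ≤ r k)
    (h0 : ∀ x, F 0 x = 0) {n : ℕ}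
    (hstep : ∀ k < n, ∀ c, L2Le μ (F k) c → L2Le μ (F (k + 1)) ((1 + L) * c + r k)) :
    ∀ k ≤ n, L2Le μ (F k) (Real.exp (L * k) * ∑ i ∈ Finset.range k, r i) := by
  intro k
  induction k with
  | zero => exact fun _ => ⟨by simp, 0, aestronglyMeasurable_zero, fun x => by simp [h0], by simp⟩
  | succ k ih =>
    intro hk
    refine (hstep k hk _ (ih (by omega))).mono_const ?_
    have hS : 0 ≤ ∑ i ∈ Finset.range k, r i := Finset.sum_nonneg fun i _ => hr i
    have h1 : 1 + L ≤ Real.exp L := by linarith [Real.add_one_le_exp L]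
    have h2 : Real.exp (L * (k + 1 : ℕ)) = Real.exp L * Real.exp (L * k) := by
      rw [← Real.exp_add]; congr 1; push_cast; ring
    have h3 : 1 ≤ Real.exp (L * (k + 1 : ℕ)) := Real.one_le_exp (by positivity)
    rw [Finset.sum_range_succ, mul_add]
    refine add_le_add ?_ (le_mul_of_one_le_left (hr k) h3)
    rw [h2, ← mul_assoc]
    gcongr

/-- Fibrewise `L²` bounds integrate to an `L²` bound on a product space. -/
theorem prod {β : Type*} [MeasurableSpace β] {ν : Measure β} [SFinite ν] [SFinite μ]
    {F : α × β → ℝ} {c : α → ℝ} (hF : Measurable F)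
    (h : ∀ x, L2Le ν (fun y => F (x, y)) (c x)) (hc : L2Le μ c a) : L2Le (μ.prod ν) F a := by
  refine ⟨hc.1, fun p => |F p|, hF.abs.aestronglyMeasurable, fun _ => le_rfl, ?_⟩
  have e : eLpNorm (fun p => |F p|) 2 (μ.prod ν) = eLpNorm F 2 (μ.prod ν) := eLpNorm_norm F
  rw [e, ← ENNReal.pow_le_pow_left_iff (n := 2) (by norm_num), eLpNorm_two_sq,
    lintegral_prod _ (by fun_prop)]
  refine le_trans (lintegral_mono fun x => ?_) hc.lintegral_le
  refine (h x).lintegral_le.trans_eq ?_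
  rw [Real.enorm_eq_ofReal (h x).1]

end L2Le

/-! ### Monte Carlo errors at deterministic points -/

section MonteCarlo

variable {d N : ℕ} {f : E d → ℝ} {g : Fin d → E d → ℝ} {κ : ℝ}

/-- The Monte Carlo error of an average of `N` i.i.d. samples is of order `N^{-1/2}` in `L²`. -/
theorem l2Le_average_sub_integral {β : Type*} [MeasurableSpace β] {γ : Measure β}
    [IsProbabilityMeasure γ] (hN : 1 ≤ N) {h : β → ℝ} (hm : AEStronglyMeasurable h γ) {c : ℝ}
    (hc : L2Le γ h c) :
    L2Le (Measure.pi fun _ : Fin N => γ)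
      (fun z => (1 / (N : ℝ)) * ∑ i, h (z i) - ∫ y, h y ∂γ) (c / √N) := by
  have hL : MemLp h 2 γ := hc.memLp hm
  have hN0 : (0 : ℝ) < N := by exact_mod_cast hN
  set ρ := Measure.pi fun _ : Fin N => γ
  have hLi : ∀ i : Fin N, MemLp (fun z : Fin N → β => h (z i)) 2 ρ := fun i =>
    hL.comp_measurePreserving (measurePreserving_eval _ i)
  set S : (Fin N → β) → ℝ := ∑ i, fun z => h (z i)
  have hS : ∀ z, S z = ∑ i, h (z i) := fun z => by simp [S]
  have hSL : MemLp S 2 ρ := memLp_finsetSum' _ fun i _ => hLi i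
  have hvar : Var[S; ρ] = N * Var[h; γ] := by
    have := variance_sum_pi (μ := fun _ : Fin N => γ) (X := fun _ => h) fun _ => hL
    simpa using this
  have hmean : ∫ z, S z ∂ρ = N * ∫ y, h y ∂γ := by
    simp_rw [hS]
    rw [integral_finsetSum _ fun i _ => (hLi i).integrable (by norm_num)]
    have : ∀ i : Fin N, ∫ z, h (z i) ∂ρ = ∫ y, h y ∂γ := fun i =>
      integral_comp_eval (μ := fun _ : Fin N => γ) (i := i) hm
    simp [this]
  have he : ∀ z, (1 / (N : ℝ)) * ∑ i, h (z i) - ∫ y, h y ∂γ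
      = (1 / (N : ℝ)) * (S z - ∫ z, S z ∂ρ) := fun z => by
    rw [hmean, hS]; field_simp
  simp_rw [he]
  refine L2Le.of_integral ((hSL.sub (memLp_const _)).const_mul _)
    (div_nonneg hc.1 (Real.sqrt_nonneg _)) ?_
  simp_rw [mul_pow]
  rw [integral_const_mul, ← variance_eq_integral hSL.1.aemeasurable, hvar, div_pow c,
    Real.sq_sqrt hN0.le]
  have hv : Var[h; γ] ≤ c ^ 2 :=
    (variance_le_expectation_sq hm).trans (hc.integral_le hm)
  rw [show (1 / (N : ℝ)) ^ 2 * (N * Var[h; γ]) = Var[h; γ] / N by field_simp]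
  gcongr

variable {γ : Measure (E d)} [IsProbabilityMeasure γ]

theorem l2Le_mean_sub_mean (hN : 1 ≤ N) {ψ : E d → ℝ} (hψ : Continuous ψ) {K : ℝ} (hK : 0 ≤ K)
    (hb : ∀ x, |ψ x| ≤ K) (x : E d) (s : ℝ) :
    L2Le (Measure.pi fun _ : Fin N => γ)
      (fun z => |mean ψ (empirical z) x s - mean ψ γ x s|) (K / √N) := by
  refine (l2Le_average_sub_integral (γ := γ) (h := fun y => ψ (x + s • y)) hN
    (Continuous.aestronglyMeasurable (by fun_prop)) (c := K)
    ((L2Le.const hK).mono fun y => (hb _).trans (le_abs_self _))).mono fun z => ?_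
  rw [mean_empirical, abs_abs, mean]

/-- The variance bound is applied to the single function `y ↦ ψ(x + s y) - ψ(x' + s' y)`, whose `L²`
norm is already proportional to the gap; thus `N^{-1/2}` and the gap multiply. -/
theorem l2Le_mean_sub_mean_sub (hN : 1 ≤ N) {ψ : E d → ℝ} {K : ℝ} (hψ : FourPoint ψ K)
    (hb : ∀ x, |ψ x| ≤ K) {M : ℝ} (hM : 1 ≤ M) (hγ : L2Le γ (fun y => ‖y‖) M)
    (x x' : E d) (s s' : ℝ) :
    L2Le (Measure.pi fun _ : Fin N => γ)
      (fun z => |(mean ψ (empirical z) x s - mean ψ γ x s)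
        - (mean ψ (empirical z) x' s' - mean ψ γ x' s')|)
      (K * M * (‖x - x'‖ + |s - s'|) / √N) := by
  have hc := hψ.continuous
  have hK := hψ.nonneg
  have h1 : L2Le γ (fun y => ψ (x + s • y) - ψ (x' + s' • y))
      (K * M * (‖x - x'‖ + |s - s'|)) := by
    have h2 : L2Le γ (fun y => K * (‖x - x'‖ + |s - s'| * ‖y‖))
        (K * (‖x - x'‖ + |s - s'| * M)) :=
      ((L2Le.const (norm_nonneg _)).add (hγ.const_mul (abs_nonneg _))).const_mul hK
    refine (h2.mono_const ?_).mono fun y => ?_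
    · have := mul_le_mul_of_nonneg_right hM (norm_nonneg (x - x'))
      rw [mul_assoc]
      refine mul_le_mul_of_nonneg_left ?_ hK
      linarith
    · refine le_trans ?_ (le_abs_self _)
      refine (hψ.lipschitz _ _).trans (mul_le_mul_of_nonneg_left ?_ hK)
      have : x + s • y - (x' + s' • y) = (x - x') + (s - s') • y := by rw [sub_smul]; abel
      rw [this]
      refine (norm_add_le _ _).trans_eq ?_
      rw [norm_smul, Real.norm_eq_abs]
  refine (l2Le_average_sub_integral (γ := γ) hN
    (Continuous.aestronglyMeasurable (by fun_prop)) h1).mono fun z => ?_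
  rw [mean_empirical, mean_empirical, abs_abs, mean, mean,
    integral_sub (integrable_comp_affine hc hb x s) (integrable_comp_affine hc hb x' s'),
    Finset.sum_sub_distrib]
  apply le_of_eq
  congr 1
  ring

theorem DriftData.l2Le_deviation (h : DriftData f g κ) (hN : 1 ≤ N) (x : E d) (s : ℝ) :
    L2Le (Measure.pi fun _ : Fin N => γ) (fun z => deviation f g (empirical z) γ x s)
      ((d + 1) * κ / √N) := by
  have h0 : 0 ≤ κ := zero_le_one.trans h.one_le
  refine ((l2Le_mean_sub_mean hN h.fourPoint.continuous h0 h.abs_le x s).add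
    (L2Le.sum Finset.univ fun k _ =>
      l2Le_mean_sub_mean hN (h.fourPoint_g k).continuous h0 (h.bound k) x s)).mono_const ?_
  simp only [Finset.sum_const, Finset.card_univ, Fintype.card_fin, nsmul_eq_mul]
  apply le_of_eq
  ring

theorem DriftData.l2Le_deviationDiff (h : DriftData f g κ) (hN : 1 ≤ N) {M : ℝ} (hM : 1 ≤ M)
    (hγ : L2Le γ (fun y => ‖y‖) M) (x x' : E d) (s s' : ℝ) :
    L2Le (Measure.pi fun _ : Fin N => γ)
      (fun z => deviationDiff f g (empirical z) γ x x' s s')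
      ((d + 1) * κ * M / √N * (‖x - x'‖ + |s - s'|)) := by
  refine ((l2Le_mean_sub_mean_sub hN h.fourPoint h.abs_le hM hγ x x' s s').add
    (L2Le.sum Finset.univ fun k _ => l2Le_mean_sub_mean_sub hN (h.fourPoint_g k) (h.bound k)
      hM hγ x x' s s')).mono_const ?_
  simp only [Finset.sum_const, Finset.card_univ, Fintype.card_fin, nsmul_eq_mul]
  apply le_of_eq
  ring

theorem l2Le_absMoment_sub (hN : 1 ≤ N) {M : ℝ} (hγ : L2Le γ (fun y => ‖y‖) M) :
    L2Le (Measure.pi fun _ : Fin N => γ)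
      (fun z => absMoment (empirical z) - absMoment γ) (M / √N) := by
  refine (l2Le_average_sub_integral (γ := γ) hN
    continuous_norm.aestronglyMeasurable hγ).mono fun z => ?_
  rw [absMoment, integral_empirical, absMoment]

/-- A bounded quantity of order `c` in `L²` remains of that order, up to a Monte Carlo error,
after multiplication by the empirical absolute moment. -/
theorem L2Le.mul_one_add_absMoment (hN : 1 ≤ N) {M : ℝ} (hγ : L2Le γ (fun y => ‖y‖) M)
    (hγM : absMoment γ ≤ M) {u : (Fin N → E d) → ℝ} {c K : ℝ} (hK : 0 ≤ K)
    (hu0 : ∀ z, 0 ≤ u z) (huK : ∀ z, u z ≤ K)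
    (hu : L2Le (Measure.pi fun _ : Fin N => γ) u c) :
    L2Le (Measure.pi fun _ : Fin N => γ) (fun z => u z * (1 + absMoment (empirical z)))
      (c * (1 + M) + K * (M / √N)) := by
  have hM : 0 ≤ M := hγ.1
  refine ((hu.mul_const (by linarith)).add
    (((l2Le_absMoment_sub hN hγ).mono (F := fun z => |absMoment (empirical z) - absMoment γ|)
      fun z => (abs_abs _).le).const_mul hK)).of_le
    (fun z => mul_nonneg (hu0 z) (by linarith [absMoment_nonneg (empirical z)])) fun z => ?_
  -- The empirical moment is at most `M` plus its fluctuation. Bounding `u` by the constant `K`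
  -- against the fluctuation avoids an `L²` bound on a product of two random factors.
  have h1 := le_abs_self (absMoment (empirical z) - absMoment γ)
  calc u z * (1 + absMoment (empirical z))
      ≤ u z * (1 + M + |absMoment (empirical z) - absMoment γ|) :=
        mul_le_mul_of_nonneg_left (by linarith) (hu0 z)
    _ = u z * (1 + M) + u z * |absMoment (empirical z) - absMoment γ| := by ring
    _ ≤ u z * (1 + M) + K * |absMoment (empirical z) - absMoment γ| := by
        gcongr; exact huK z

end MonteCarlo

/-! ### Schemes for a fixed noise path: `L²` estimates in the samples -/

variable {d N : ℕ}

/-- The additive-noise scheme with step `δ`, drifts `b k` and noise increments `ξ k`, started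
at `0`. -/
noncomputable def scheme (δ : ℝ) (b : ℕ → E d → E d) (ξ : ℕ → E d) : ℕ → E d
  | 0 => 0
  | k + 1 => scheme δ b ξ k + δ • b k (scheme δ b ξ k) + ξ k

/-- The noise increments over pairs of consecutive steps. -/
noncomputable def pairSum (ξ : ℕ → E d) (j : ℕ) : E d := ξ (2 * j) + ξ (2 * j + 1)

/-- The common noise cancels and the drifts are bounded. This almost trivial deterministic bound is
the `K` needed in `L2Le.mul_one_add_absMoment`. -/
theorem norm_scheme_sub_le {δ B : ℝ} (hδ : 0 ≤ δ) {b b' : ℕ → E d → E d} {ξ : ℕ → E d}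
    (hb : ∀ k x, ‖b k x‖ ≤ B) (hb' : ∀ k x, ‖b' k x‖ ≤ B) (k : ℕ) :
    ‖scheme δ b ξ k - scheme δ b' ξ k‖ ≤ 2 * B * (δ * k) := by
  induction k with
  | zero => simp [scheme]
  | succ k ih =>
    have e : scheme δ b ξ (k + 1) - scheme δ b' ξ (k + 1)
        = (scheme δ b ξ k - scheme δ b' ξ k)
          + δ • (b k (scheme δ b ξ k) - b' k (scheme δ b' ξ k)) := by
      simp only [scheme, smul_sub]; abel
    rw [e]
    refine (norm_add_le _ _).trans ?_
    rw [norm_smul, Real.norm_eq_abs, abs_of_nonneg hδ]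
    have h2 : ‖b k (scheme δ b ξ k) - b' k (scheme δ b' ξ k)‖ ≤ 2 * B := by
      refine (norm_sub_le _ _).trans ?_
      linarith [hb k (scheme δ b ξ k), hb' k (scheme δ b' ξ k)]
    push_cast
    nlinarith [mul_le_mul_of_nonneg_left h2 hδ]

/-- A probability measure whose absolute moments up to order two are controlled by `M ≥ 1`. -/
structure MomentBound (γ : Measure (E d)) (M : ℝ) : Prop where
  one_le : 1 ≤ M
  l2Le : L2Le γ (fun z => ‖z‖) M
  absMoment_le : absMoment γ ≤ M

theorem MomentBound.integrable {γ : Measure (E d)} [IsProbabilityMeasure γ] {M : ℝ}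
    (h : MomentBound γ M) : Integrable (fun z => ‖z‖) γ :=
  (h.l2Le.memLp continuous_norm.aestronglyMeasurable).integrable (by norm_num)

section Conditional

variable {f : E d → ℝ} {g : Fin d → E d → ℝ} {κ M : ℝ} {γ : Measure (E d)}
  [IsProbabilityMeasure γ]

/-- The drifts at the grid points attached to the noise levels `s k`. -/
noncomputable def gridDrift (f : E d → ℝ) (g : Fin d → E d → ℝ) (μ : Measure (E d)) (s : ℕ → ℝ)
    (k : ℕ) (x : E d) : E d := ratioDrift f g μ x (s k)

/-- The constant in the `L²` estimate of a scheme with Monte Carlo drift. -/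
noncomputable def schemeConst (d : ℕ) (κ M : ℝ) : ℝ :=
  Real.exp (driftConst d κ M) * (driftConst d κ M * ((d + 1) * κ))

/-- Passing through the drift of `μ` at `x` leaves the deviation at `x` alone. -/
theorem DriftData.norm_gridDrift_sub_le (h : DriftData f g κ) (hM : 1 ≤ M) {μ : Measure (E d)}
    [IsProbabilityMeasure μ] (hμ : Integrable (fun z => ‖z‖) μ) (s : ℕ → ℝ) (k : ℕ)
    (y x : E d) :
    ‖gridDrift f g μ s k y - gridDrift f g γ s k x‖
      ≤ driftConst d κ M * (‖y - x‖ + deviation f g μ γ x (s k)) := by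
  refine (norm_sub_le_norm_sub_add_norm_sub _ (gridDrift f g μ s k x) _).trans ?_
  rw [mul_add]
  refine add_le_add ?_ (h.norm_ratioDrift_sub_le_deviation hM μ γ x (s k))
  simpa [gridDrift] using h.norm_ratioDrift_sub_le hM μ hμ y x (s k) (s k)

/-- Grönwall in `L²` of the samples: for fixed `ξ` the exact scheme does not depend on them, so each
step adds a Monte Carlo error at a deterministic point, of order `δ N^{-1/2}`, over at most `1/δ`
steps. -/
theorem DriftData.l2Le_scheme_sub (h : DriftData f g κ) (hM : 1 ≤ M) (hN : 1 ≤ N) {δ : ℝ}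
    (hδ : 0 < δ) (s : ℕ → ℝ) (ξ : ℕ → E d) {k : ℕ} (hk : δ * k ≤ 1) :
    L2Le (Measure.pi fun _ : Fin N => γ)
      (fun z => ‖scheme δ (gridDrift f g (empirical z) s) ξ k
        - scheme δ (gridDrift f g γ s) ξ k‖) (schemeConst d κ M / √N) := by
  have hB : 0 < driftConst d κ M := driftConst_pos h.one_le hM
  set B := driftConst d κ M with hBdef
  have hκ : 0 ≤ κ := zero_le_one.trans h.one_le
  set q := (d + 1) * κ / √N with hq
  have hq0 : 0 ≤ q := by positivity
  have hg := L2Le.gronwall (μ := Measure.pi fun _ : Fin N => γ) (L := δ * B)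
    (F := fun k z => ‖scheme δ (gridDrift f g (empirical z) s) ξ k
        - scheme δ (gridDrift f g γ s) ξ k‖) (r := fun _ => δ * (B * q)) (n := k)
    (by positivity) (fun _ => by positivity) (fun z => by simp [scheme]) ?_ k le_rfl
  · refine hg.mono_const ?_
    rw [Finset.sum_const, Finset.card_range, nsmul_eq_mul, schemeConst, ← hBdef]
    have e : Real.exp B * (B * ((d + 1) * κ)) / √N = Real.exp B * (1 * (B * q)) := by
      rw [hq]; ring
    rw [e]
    have h1 : δ * B * k ≤ B := by nlinarith
    have h2 : (k : ℝ) * (δ * (B * q)) ≤ 1 * (B * q) := by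
      have : 0 ≤ B * q := by positivity
      nlinarith
    gcongr
  · intro k _ c hc
    set X := scheme δ (gridDrift f g γ s) ξ
    have hdev := h.l2Le_deviation (γ := γ) hN (X k) (s k)
    refine ((hc.add (((hc.add hdev).const_mul hB.le).const_mul hδ.le)).of_le
      (fun z => norm_nonneg _) fun z => ?_).mono_const ?_
    · have : IsProbabilityMeasure (empirical z) := isProbabilityMeasure_empirical hN z
      set Y := scheme δ (gridDrift f g (empirical z) s) ξ
      have e : Y (k + 1) - X (k + 1) = (Y k - X k)
          + δ • (gridDrift f g (empirical z) s k (Y k) - gridDrift f g γ s k (X k)) := by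
        simp only [X, Y, scheme, smul_sub]; abel
      rw [e]
      refine (norm_add_le _ _).trans (add_le_add_right ?_ _)
      rw [norm_smul, Real.norm_eq_abs, abs_of_nonneg hδ.le]
      exact mul_le_mul_of_nonneg_left
        (h.norm_gridDrift_sub_le hM (integrable_empirical z hN _) s k _ _) hδ.le
    · apply le_of_eq; ring

theorem DriftData.norm_scheme_sub_le (h : DriftData f g κ) (hM : 1 ≤ M) {μ ν : Measure (E d)}
    [IsProbabilityMeasure μ] [IsProbabilityMeasure ν] {δ : ℝ}
    (hδ : 0 < δ) (s : ℕ → ℝ) (ξ : ℕ → E d) {k : ℕ} (hk : δ * k ≤ 1) :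
    ‖scheme δ (gridDrift f g μ s) ξ k - scheme δ (gridDrift f g ν s) ξ k‖
      ≤ 2 * driftConst d κ M := by
  have hB : 0 < driftConst d κ M := driftConst_pos h.one_le hM
  refine (SchrodingerFollmer.norm_scheme_sub_le hδ.le
    (fun k x => h.norm_ratioDrift_le hM μ x (s k))
    (fun k x => h.norm_ratioDrift_le hM ν x (s k)) k).trans ?_
  nlinarith

/-- `L²` bound for the second difference of the drifts when the drift points `y, y'` are
themselves `N^{-1/2}`-close to deterministic points `x, x'`. -/
theorem DriftData.l2Le_four_point (h : DriftData f g κ) (hγ : MomentBound γ M) (hN : 1 ≤ N)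
    {y y' : (Fin N → E d) → E d} {x x' : E d} {s s' : ℝ} {c c₁ c₂ : ℝ}
    (hc : L2Le (Measure.pi fun _ : Fin N => γ) (fun z => ‖y z - y' z - x + x'‖) c)
    (h₁ : L2Le (Measure.pi fun _ : Fin N => γ) (fun z => ‖y z - x‖) (c₁ / √N))
    (h₂ : L2Le (Measure.pi fun _ : Fin N => γ) (fun z => ‖y' z - x'‖) (c₂ / √N))
    (hb₁ : ∀ z, ‖y z - x‖ ≤ 2 * driftConst d κ M)
    (hb₂ : ∀ z, ‖y' z - x'‖ ≤ 2 * driftConst d κ M) :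
    L2Le (Measure.pi fun _ : Fin N => γ)
      (fun z => ‖ratioDrift f g (empirical z) (y z) s - ratioDrift f g (empirical z) (y' z) s'
        - ratioDrift f g γ x s + ratioDrift f g γ x' s'‖)
      (driftConst d κ M * (c + ((c₁ + c₂) * (1 + M) + 4 * driftConst d κ M * M
        + (d + 1) * κ * M + 2 * ((d + 1) * κ)) / √N * (‖x - x'‖ + |s - s'|))) := by
  have hM := hγ.one_le
  have hB : 0 < driftConst d κ M := driftConst_pos h.one_le hM
  set B := driftConst d κ M with hBdef
  set H := ‖x - x'‖ + |s - s'|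
  have hH : 0 ≤ H := by positivity
  have hu := L2Le.mul_one_add_absMoment hN hγ.l2Le hγ.absMoment_le (K := 4 * B)
    (by positivity) (fun z => by positivity) (fun z => by linarith [hb₁ z, hb₂ z]) (h₁.add h₂)
  have hθ := h.l2Le_deviationDiff (γ := γ) hN hM hγ.l2Le x x' s s'
  have hη := (h.l2Le_deviation (γ := γ) hN x s).add (h.l2Le_deviation (γ := γ) hN x' s')
  refine (((((hc.add (hu.mul_const hH)).add hθ).add (hη.mul_const hH)).const_mul hB.le).of_le
    (fun z => norm_nonneg _) fun z => ?_).mono_const ?_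
  · have : IsProbabilityMeasure (empirical z) := isProbabilityMeasure_empirical hN z
    exact h.norm_ratioDrift_four_point_le hM (empirical z) γ (integrable_empirical z hN _)
      hγ.integrable hγ.absMoment_le (y z) (y' z) x x' s s'
  · apply le_of_eq; ring

/-- The constant in the `L²` estimate of the second difference of the schemes. -/
noncomputable def pairConst (d : ℕ) (κ M : ℝ) : ℝ :=
  driftConst d κ M * (2 * schemeConst d κ M * (1 + M) + 4 * driftConst d κ M * M
    + (d + 1) * κ * M + 2 * ((d + 1) * κ)
    + driftConst d κ M * (schemeConst d κ M + (d + 1) * κ))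

/-- The discretisation gap between the exact fine and coarse schemes over the `j`-th coarse
step. -/
noncomputable def levelGap (δ : ℝ) (s : ℕ → ℝ) (x x' : ℕ → E d) (j : ℕ) : ℝ :=
  ‖x (2 * j) - x' j‖ + (‖x (2 * j + 1) - x' j‖ + |s (2 * j + 1) - s (2 * j)|) + δ

theorem levelGap_nonneg {δ : ℝ} (hδ : 0 ≤ δ) (s : ℕ → ℝ) (x x' : ℕ → E d) (j : ℕ) :
    0 ≤ levelGap δ s x x' j := by
  unfold levelGap; positivity

/-- For a fixed noise path, the second difference of the schemes (Monte Carlo against exact, fine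
against coarse) is, in `L²` of the samples, of order `N^{-1/2}` times the discretisation gap. -/
theorem DriftData.l2Le_secondDifference (h : DriftData f g κ) (hγ : MomentBound γ M)
    (hN : 1 ≤ N) {δ : ℝ} (hδ : 0 < δ) (s : ℕ → ℝ) (ξ : ℕ → E d) {m : ℕ}
    (hm : 2 * δ * m ≤ 1) :
    L2Le (Measure.pi fun _ : Fin N => γ)
      (fun z => ‖scheme δ (gridDrift f g (empirical z) s) ξ (2 * m)
        - scheme (2 * δ) (gridDrift f g (empirical z) fun j => s (2 * j)) (pairSum ξ) m
        - scheme δ (gridDrift f g γ s) ξ (2 * m)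
        + scheme (2 * δ) (gridDrift f g γ fun j => s (2 * j)) (pairSum ξ) m‖)
      (Real.exp (driftConst d κ M) * (pairConst d κ M / √N *
        ∑ j ∈ Finset.range m, δ * levelGap δ s (scheme δ (gridDrift f g γ s) ξ)
          (scheme (2 * δ) (gridDrift f g γ fun j => s (2 * j)) (pairSum ξ)) j)) := by
  have hM := hγ.one_le
  have hB : 0 < driftConst d κ M := driftConst_pos h.one_le hM
  have hκ : 0 ≤ κ := zero_le_one.trans h.one_le
  set B := driftConst d κ M with hBdef
  have hS0 : 0 ≤ schemeConst d κ M := by unfold schemeConst; rw [← hBdef]; positivity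
  have hP0 : 0 ≤ pairConst d κ M := by unfold pairConst; rw [← hBdef]; positivity
  set X := scheme δ (gridDrift f g γ s) ξ
  set X' := scheme (2 * δ) (gridDrift f g γ fun j => s (2 * j)) (pairSum ξ)
  set Y := fun z : Fin N → E d => scheme δ (gridDrift f g (empirical z) s) ξ
  set Y' := fun z : Fin N → E d =>
    scheme (2 * δ) (gridDrift f g (empirical z) fun j => s (2 * j)) (pairSum ξ)
  have h2δ : 0 < 2 * δ := by linarith
  have hG0 := levelGap_nonneg hδ.le s X X'
  -- Grönwall runs over coarse steps, each made of two fine steps; hence the rate `2 * δ * B`.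
  have hg := L2Le.gronwall (μ := Measure.pi fun _ : Fin N => γ) (L := 2 * δ * B)
    (F := fun j z => ‖Y z (2 * j) - Y' z j - X (2 * j) + X' j‖)
    (r := fun j => pairConst d κ M / √N * (δ * levelGap δ s X X' j)) (n := m)
    (by positivity) (fun j => by have := hG0 j; positivity)
    (fun z => by simp [X, X', Y, Y', scheme]) ?_ m le_rfl
  · refine hg.mono_const ?_
    rw [← Finset.mul_sum]
    have : 2 * δ * B * m ≤ B := by nlinarith
    have h0 : 0 ≤ ∑ j ∈ Finset.range m, δ * levelGap δ s X X' j :=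
      Finset.sum_nonneg fun j _ => mul_nonneg hδ.le (hG0 j)
    gcongr
  · intro j hj c hc
    have hjm : (j : ℝ) + 1 ≤ m := by exact_mod_cast hj
    have t1 : δ * (2 * j : ℕ) ≤ 1 := by push_cast; nlinarith
    have t2 : δ * (2 * j + 1 : ℕ) ≤ 1 := by push_cast; nlinarith
    have t3 : 2 * δ * (j : ℕ) ≤ 1 := by nlinarith
    have u1 := h.l2Le_scheme_sub (γ := γ) hM hN hδ s ξ t1
    have u2 := h.l2Le_scheme_sub (γ := γ) hM hN hδ s ξ t2
    have u3 := h.l2Le_scheme_sub (γ := γ) hM hN h2δ (fun j => s (2 * j)) (pairSum ξ) t3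
    have hp : ∀ z : Fin N → E d, IsProbabilityMeasure (empirical z) :=
      isProbabilityMeasure_empirical hN
    have b1 : ∀ z, ‖Y z (2 * j) - X (2 * j)‖ ≤ 2 * B := fun z =>
      h.norm_scheme_sub_le hM hδ s ξ t1
    have b2 : ∀ z, ‖Y z (2 * j + 1) - X (2 * j + 1)‖ ≤ 2 * B := fun z =>
      h.norm_scheme_sub_le hM hδ s ξ t2
    have b3 : ∀ z, ‖Y' z j - X' j‖ ≤ 2 * B := fun z =>
      h.norm_scheme_sub_le hM h2δ (fun j => s (2 * j)) (pairSum ξ) t3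
    have dev := h.l2Le_deviation (γ := γ) hN (X (2 * j)) (s (2 * j))
    -- The coarse drift is frozen over the whole coarse step, so the midpoint of the fine scheme is
    -- compared with the coarse value at time `j`. The noise `ξ (2 * j)` cancels between `Y` and
    -- `X`.
    have mid : L2Le (Measure.pi fun _ : Fin N => γ)
        (fun z => ‖Y z (2 * j + 1) - Y' z j - X (2 * j + 1) + X' j‖)
        (c + δ * (B * (schemeConst d κ M / √N + (d + 1) * κ / √N))) := by
      refine (hc.add (((u1.add dev).const_mul hB.le).const_mul hδ.le)).of_le
        (fun z => norm_nonneg _) fun z => ?_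
      have := hp z
      have e : Y z (2 * j + 1) - Y' z j - X (2 * j + 1) + X' j
          = (Y z (2 * j) - Y' z j - X (2 * j) + X' j)
            + δ • (gridDrift f g (empirical z) s (2 * j) (Y z (2 * j))
              - gridDrift f g γ s (2 * j) (X (2 * j))) := by
        simp only [X, Y, scheme, smul_sub]; abel
      rw [e]
      refine (norm_add_le _ _).trans (add_le_add_right ?_ _)
      rw [norm_smul, Real.norm_eq_abs, abs_of_nonneg hδ.le]
      exact mul_le_mul_of_nonneg_left
        (h.norm_gridDrift_sub_le hM (integrable_empirical z hN _) s (2 * j) _ _) hδ.le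
    have q1 := h.l2Le_four_point hγ hN (s := s (2 * j)) (s' := s (2 * j)) hc u1 u3 b1 b3
    have q2 := h.l2Le_four_point hγ hN (s := s (2 * j + 1)) (s' := s (2 * j)) mid u2 u3 b2 b3
    refine ((hc.add ((q1.add q2).const_mul hδ.le)).of_le (fun z => norm_nonneg _)
      fun z => ?_).mono_const ?_
    -- The coarse step `2δ` is cut into two halves, each matched with one fine step; all noise
    -- cancels.
    · have e : Y z (2 * (j + 1)) - Y' z (j + 1) - X (2 * (j + 1)) + X' (j + 1)
          = (Y z (2 * j) - Y' z j - X (2 * j) + X' j)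
            + (δ • (ratioDrift f g (empirical z) (Y z (2 * j)) (s (2 * j))
                - ratioDrift f g (empirical z) (Y' z j) (s (2 * j))
                - ratioDrift f g γ (X (2 * j)) (s (2 * j))
                + ratioDrift f g γ (X' j) (s (2 * j)))
              + δ • (ratioDrift f g (empirical z) (Y z (2 * j + 1)) (s (2 * j + 1))
                - ratioDrift f g (empirical z) (Y' z j) (s (2 * j))
                - ratioDrift f g γ (X (2 * j + 1)) (s (2 * j + 1))
                + ratioDrift f g γ (X' j) (s (2 * j)))) := by
        simp only [X, Y, X', Y', show 2 * (j + 1) = 2 * j + 1 + 1 by ring, scheme, pairSum,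
          gridDrift, smul_sub, smul_add, two_mul δ, add_smul]
        abel
      rw [e]
      refine (norm_add_le _ _).trans (add_le_add_right ((norm_add_le _ _).trans_eq ?_) _)
      rw [norm_smul, norm_smul, Real.norm_eq_abs, abs_of_nonneg hδ.le, mul_add]
    · rw [← hBdef]
      have hH1 : 0 ≤ ‖X (2 * j) - X' j‖ := norm_nonneg _
      have hH2 : 0 ≤ ‖X (2 * j + 1) - X' j‖ + |s (2 * j + 1) - s (2 * j)| := by positivity
      rw [levelGap, pairConst, ← hBdef, sub_self, abs_zero, add_zero]
      set H1 := ‖X (2 * j) - X' j‖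
      set H2 := ‖X (2 * j + 1) - X' j‖ + |s (2 * j + 1) - s (2 * j)|
      set S := schemeConst d κ M
      have hN' : 0 ≤ (√N)⁻¹ := by positivity
      -- These are the terms of `pairConst * levelGap` that are not needed. The summand `δ` of
      -- `levelGap` is there to pay for the extra midpoint error in `mid`.
      have z1 : 0 ≤ (√N)⁻¹ * δ * B * B * (S + (d + 1) * κ) * (H1 + H2) := by positivity
      have z2 : 0 ≤ (√N)⁻¹ * δ * B * ((S + S) * (1 + M) + 4 * B * M
        + (d + 1) * κ * M + 2 * ((d + 1) * κ)) * δ := by positivity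
      simp only [div_eq_mul_inv]
      linarith

end Conditional

/-! ### Averaging over the noise path -/

section Paths

variable {d N : ℕ} {f : E d → ℝ} {g : Fin d → E d → ℝ} {κ M : ℝ} {γ : Measure (E d)}
  [IsProbabilityMeasure γ]

/-- The constant in the strong error between the exact schemes at consecutive levels, for noise
increments of size `c √δ`. -/
noncomputable def gapConst (d : ℕ) (κ M c : ℝ) : ℝ :=
  Real.exp (driftConst d κ M) * (driftConst d κ M * (driftConst d κ M + c + M))

/-- The displacement of the exact fine scheme between the start and the middle of a coarse step. -/
theorem DriftData.norm_scheme_succ_sub_le (h : DriftData f g κ) (hM : 1 ≤ M) {δ : ℝ}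
    (hδ : 0 < δ) (s : ℕ → ℝ) (ξ : ℕ → E d) (k : ℕ) (x : E d) :
    ‖scheme δ (gridDrift f g γ s) ξ (k + 1) - x‖
      ≤ ‖scheme δ (gridDrift f g γ s) ξ k - x‖ + (driftConst d κ M * δ + ‖ξ k‖) := by
  set X := scheme δ (gridDrift f g γ s) ξ
  have e : X (k + 1) - x = (X k - x) + (δ • gridDrift f g γ s k (X k) + ξ k) := by
    simp only [X, scheme]; abel
  rw [e]
  refine (norm_add_le _ _).trans (add_le_add_right ((norm_add_le _ _).trans
    (add_le_add_left ?_ _)) _)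
  rw [norm_smul, Real.norm_eq_abs, abs_of_pos hδ, mul_comm]
  exact mul_le_mul_of_nonneg_right (h.norm_ratioDrift_le hM γ _ _) hδ.le

variable {Ω : Type*} [MeasurableSpace Ω] {ρ : Measure Ω} [IsProbabilityMeasure ρ]

/-- Strong error of order one half. The total noise over a coarse step is shared, so only drift
differences remain; at the midpoint these see one noise increment and one change of noise level,
both of order `√δ`. -/
theorem DriftData.l2Le_level_sub (h : DriftData f g κ) (hγ : MomentBound γ M) {δ : ℝ}
    (hδ : 0 < δ) (hδ1 : δ ≤ 1) {s : ℕ → ℝ} (hs : ∀ k, |s (k + 1) - s k| ≤ √δ)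
    {ξ : ℕ → Ω → E d} {c : ℝ} (hξ : ∀ k, L2Le ρ (fun ω => ‖ξ k ω‖) (c * √δ)) (hc : 0 ≤ c)
    {j : ℕ} (hj : 2 * δ * j ≤ 1) :
    L2Le ρ (fun ω => ‖scheme δ (gridDrift f g γ s) (fun k => ξ k ω) (2 * j)
        - scheme (2 * δ) (gridDrift f g γ fun j => s (2 * j)) (pairSum fun k => ξ k ω) j‖)
      (gapConst d κ M c * √δ) := by
  have hM := hγ.one_le
  have hB : 0 < driftConst d κ M := driftConst_pos h.one_le hM
  set B := driftConst d κ M with hBdef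
  set q := (B + c + M) * √δ with hq
  have hq0 : 0 ≤ q := by positivity
  have hδs : δ ≤ √δ := Real.le_sqrt_of_sq_le (by nlinarith)
  set X := fun ω => scheme δ (gridDrift f g γ s) (fun k => ξ k ω)
  set X' := fun ω => scheme (2 * δ) (gridDrift f g γ fun j => s (2 * j))
    (pairSum fun k => ξ k ω)
  have hg := L2Le.gronwall (μ := ρ) (L := 2 * δ * B)
    (F := fun j ω => ‖X ω (2 * j) - X' ω j‖) (r := fun _ => δ * (B * q)) (n := j)
    (by positivity) (fun _ => by positivity) (fun ω => by simp [X, X', scheme]) ?_ j le_rfl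
  · refine hg.mono_const ?_
    rw [Finset.sum_const, Finset.card_range, nsmul_eq_mul, gapConst, ← hBdef]
    have e : Real.exp B * (B * (B + c + M)) * √δ = Real.exp B * (1 * (B * q)) := by
      rw [hq]; ring
    rw [e]
    have hj0 : 0 ≤ δ * j := by positivity
    have h1 : 2 * δ * B * j ≤ B := by nlinarith
    have h2 : (j : ℝ) * (δ * (B * q)) ≤ 1 * (B * q) := by
      have : 0 ≤ B * q := by positivity
      nlinarith
    gcongr
  · intro j _ a ha
    have hsum : L2Le ρ (fun ω => ‖X ω (2 * j) - X' ω j‖ + (B * δ + ‖ξ (2 * j) ω‖) + √δ * M)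
        (a + (B * δ + c * √δ) + √δ * M) :=
      (ha.add ((L2Le.const (by positivity)).add (hξ (2 * j)))).add
        (L2Le.const (by positivity))
    refine ((ha.add (((ha.const_mul hB.le).add (hsum.const_mul hB.le)).const_mul hδ.le)).of_le
      (fun ω => norm_nonneg _) fun ω => ?_).mono_const ?_
    · have e : X ω (2 * (j + 1)) - X' ω (j + 1) = (X ω (2 * j) - X' ω j)
          + (δ • (ratioDrift f g γ (X ω (2 * j)) (s (2 * j))
              - ratioDrift f g γ (X' ω j) (s (2 * j)))
            + δ • (ratioDrift f g γ (X ω (2 * j + 1)) (s (2 * j + 1))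
              - ratioDrift f g γ (X' ω j) (s (2 * j)))) := by
        simp only [X, X', show 2 * (j + 1) = 2 * j + 1 + 1 by ring, scheme, pairSum,
          gridDrift, smul_sub, two_mul δ, add_smul]
        abel
      rw [e]
      refine (norm_add_le _ _).trans (add_le_add_right ((norm_add_le _ _).trans ?_) _)
      rw [norm_smul, norm_smul, Real.norm_eq_abs, abs_of_nonneg hδ.le, ← mul_add]
      refine mul_le_mul_of_nonneg_left (add_le_add ?_ ?_) hδ.le
      · simpa using h.norm_ratioDrift_sub_le hM γ hγ.integrable (X ω (2 * j)) (X' ω j)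
          (s (2 * j)) (s (2 * j))
      · refine (h.norm_ratioDrift_sub_le hM γ hγ.integrable _ _ _ _).trans
          (mul_le_mul_of_nonneg_left (add_le_add
            (h.norm_scheme_succ_sub_le hM hδ s (fun k => ξ k ω) (2 * j) (X' ω j)) ?_) hB.le)
        have := absMoment_nonneg γ
        exact mul_le_mul (hs _) hγ.absMoment_le this (Real.sqrt_nonneg _)
    · have : δ * B * (B * δ) ≤ δ * B * (B * √δ) := by gcongr
      rw [hq]
      linarith

/-- The constant in the `L²` estimate of `levelGap`. -/
noncomputable def levelGapConst (d : ℕ) (κ M c : ℝ) : ℝ :=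
  2 * gapConst d κ M c + driftConst d κ M + c + 2

theorem DriftData.l2Le_levelGap (h : DriftData f g κ) (hγ : MomentBound γ M) {δ : ℝ}
    (hδ : 0 < δ) (hδ1 : δ ≤ 1) {s : ℕ → ℝ} (hs : ∀ k, |s (k + 1) - s k| ≤ √δ)
    {ξ : ℕ → Ω → E d} {c : ℝ} (hξ : ∀ k, L2Le ρ (fun ω => ‖ξ k ω‖) (c * √δ)) (hc : 0 ≤ c)
    {j : ℕ} (hj : 2 * δ * j ≤ 1) :
    L2Le ρ (fun ω => levelGap δ s (scheme δ (gridDrift f g γ s) fun k => ξ k ω)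
        (scheme (2 * δ) (gridDrift f g γ fun j => s (2 * j)) (pairSum fun k => ξ k ω)) j)
      (levelGapConst d κ M c * √δ) := by
  have hM := hγ.one_le
  have hB : 0 < driftConst d κ M := driftConst_pos h.one_le hM
  have hδs : δ ≤ √δ := Real.le_sqrt_of_sq_le (by nlinarith)
  have h1 := h.l2Le_level_sub hγ hδ hδ1 hs hξ hc hj
  have h2 : L2Le ρ (fun _ => driftConst d κ M * δ) (driftConst d κ M * δ) :=
    L2Le.const (by positivity)
  refine (((h1.add ((h1.add (h2.add (hξ (2 * j)))).add (L2Le.const (Real.sqrt_nonneg δ)))).add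
    (L2Le.const hδ.le)).of_le (fun ω => levelGap_nonneg hδ.le _ _ _ _)
    fun ω => ?_).mono_const ?_
  · unfold levelGap
    gcongr
    · exact h.norm_scheme_succ_sub_le hM hδ s (fun k => ξ k ω) (2 * j) _
    · exact hs _
  · have := mul_le_mul_of_nonneg_left hδs hB.le
    unfold levelGapConst
    linarith

/-- The constant in the final estimate. -/
noncomputable def finalConst (d : ℕ) (κ M c A : ℝ) : ℝ :=
  A * (Real.exp (driftConst d κ M) * (pairConst d κ M * levelGapConst d κ M c)
    + 2 * schemeConst d κ M * gapConst d κ M c)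

/-- The second difference of `φ` over the four schemes is of order `(δ / N)^{1/2}` in `L²` of the
product of the laws of the noise and of the samples. -/
theorem DriftData.l2Le_prod_secondDifference (h : DriftData f g κ) (hγ : MomentBound γ M)
    (hN : 1 ≤ N) {δ : ℝ} (hδ : 0 < δ) (hδ1 : δ ≤ 1) {s : ℕ → ℝ}
    (hs : ∀ k, |s (k + 1) - s k| ≤ √δ) {ξ : ℕ → Ω → E d} {c : ℝ}
    (hξ : ∀ k, L2Le ρ (fun ω => ‖ξ k ω‖) (c * √δ)) (hc : 0 ≤ c) {m : ℕ}
    (hm : 2 * δ * m ≤ 1) {φ : E d → ℝ} {A : ℝ} (hφ : FourPoint φ A)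
    {F : Ω × (Fin N → E d) → ℝ} (hFm : Measurable F) (hF : ∀ p, F p =
      φ (scheme δ (gridDrift f g (empirical p.2) s) (fun k => ξ k p.1) (2 * m))
      - φ (scheme (2 * δ) (gridDrift f g (empirical p.2) fun j => s (2 * j))
        (pairSum fun k => ξ k p.1) m)
      - φ (scheme δ (gridDrift f g γ s) (fun k => ξ k p.1) (2 * m))
      + φ (scheme (2 * δ) (gridDrift f g γ fun j => s (2 * j)) (pairSum fun k => ξ k p.1) m)) :
    L2Le (ρ.prod (Measure.pi fun _ : Fin N => γ)) F
      (finalConst d κ M c A * √δ / √N) := by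
  have hM := hγ.one_le
  have hB : 0 < driftConst d κ M := driftConst_pos h.one_le hM
  have hκ : 0 ≤ κ := zero_le_one.trans h.one_le
  have hA := hφ.nonneg
  have hS0 : 0 ≤ schemeConst d κ M := by unfold schemeConst; positivity
  have hP0 : 0 ≤ pairConst d κ M := by unfold pairConst; positivity
  have hG0 : 0 ≤ gapConst d κ M c := by unfold gapConst; positivity
  have hL0 : 0 ≤ levelGapConst d κ M c := by unfold levelGapConst; positivity
  have h2δ : 0 < 2 * δ := by linarith
  have hm1 : δ * (2 * m : ℕ) ≤ 1 := by push_cast; linarith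
  set X := fun ω => scheme δ (gridDrift f g γ s) (fun k => ξ k ω)
  set X' := fun ω => scheme (2 * δ) (gridDrift f g γ fun j => s (2 * j))
    (pairSum fun k => ξ k ω)
  -- This is the four-point bound for `φ` on the fibre over `ω`: the factor `‖X ω (2 * m) - X' ω m‖`
  -- is constant there, so the product needs only `L²` bounds in each variable separately.
  refine L2Le.prod (c := fun ω => A * (Real.exp (driftConst d κ M) * (pairConst d κ M / √N *
    ∑ j ∈ Finset.range m, δ * levelGap δ s (X ω) (X' ω) j)
    + (schemeConst d κ M / √N + schemeConst d κ M / √N) * ‖X ω (2 * m) - X' ω m‖)) hFm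
    (fun ω => ?_) ?_
  · refine (((h.l2Le_secondDifference hγ hN hδ s (fun k => ξ k ω) hm).add
      (((h.l2Le_scheme_sub (γ := γ) hM hN hδ s (fun k => ξ k ω) hm1).add
      (h.l2Le_scheme_sub (γ := γ) hM hN h2δ (fun j => s (2 * j)) (pairSum fun k => ξ k ω)
        hm)).mul_const (norm_nonneg (X ω (2 * m) - X' ω m)))).const_mul hA).mono fun z => ?_
    refine le_trans ?_ (le_abs_self _)
    rw [hF]
    exact hφ.bound _ _ _ _
  · have hsum : L2Le ρ (fun ω => ∑ j ∈ Finset.range m, δ * levelGap δ s (X ω) (X' ω) j)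
        (levelGapConst d κ M c * √δ) := by
      refine (L2Le.sum (Finset.range m) fun j hj =>
        (h.l2Le_levelGap hγ hδ hδ1 hs hξ hc ?_).const_mul hδ.le).mono_const ?_
      · have : (j : ℝ) ≤ m := by exact_mod_cast (Finset.mem_range.1 hj).le
        nlinarith
      -- There are `m` terms of size `δ√δ`, and `m * δ ≤ 1/2`.
      · rw [Finset.sum_const, Finset.card_range, nsmul_eq_mul]
        have : 0 ≤ levelGapConst d κ M c * √δ := by positivity
        have : (0 : ℝ) ≤ m * δ := by positivity
        nlinarith
    have hend := h.l2Le_level_sub hγ hδ hδ1 hs hξ hc hm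
    refine ((((hsum.const_mul (r := pairConst d κ M / √N) (by positivity)).const_mul
      (Real.exp_pos (driftConst d κ M)).le).add (hend.const_mul
      (r := schemeConst d κ M / √N + schemeConst d κ M / √N) (by positivity))).const_mul
      hA).mono_const (le_of_eq ?_)
    unfold finalConst
    ring

end Paths

/-! ### Joint measurability of the schemes in path and samples -/

section Measurability

variable {d N : ℕ} {f : E d → ℝ} {g : Fin d → E d → ℝ} {κ : ℝ}

theorem measurable_scheme {α : Type*} [MeasurableSpace α] {δ : ℝ} {b : α → ℕ → E d → E d}
    {ξ : α → ℕ → E d} (hb : ∀ k, Measurable fun p : α × E d => b p.1 k p.2)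
    (hξ : ∀ k, Measurable fun a => ξ a k) (k : ℕ) :
    Measurable fun a => scheme δ (b a) (ξ a) k := by
  induction k with
  | zero => exact measurable_const
  | succ k ih =>
    simp only [scheme]
    exact (ih.add (((hb k).comp (measurable_id.prodMk ih)).const_smul δ)).add (hξ k)

theorem DriftData.measurable_gridDrift (h : DriftData f g κ) (γ : Measure (E d))
    [IsProbabilityMeasure γ] (hγ : Integrable (fun z => ‖z‖) γ) (s : ℕ → ℝ) (k : ℕ) :
    Measurable (gridDrift f g γ s k) := by
  have hc : ∀ ψ : E d → ℝ, FourPoint ψ κ → (∀ x, |ψ x| ≤ κ) →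
      Measurable fun x => mean ψ γ x (s k) := fun ψ hψ hb => by
    refine (LipschitzWith.of_dist_le_mul (K := ⟨κ, hψ.nonneg⟩) fun x y => ?_).continuous.measurable
    rw [Real.dist_eq, dist_eq_norm]
    have := abs_mean_sub_le hψ hb hγ x y (s k) (s k)
    rw [sub_self, abs_zero, zero_mul, add_zero] at this
    exact this
  refine (WithLp.measurable_toLp 2 _).comp (measurable_pi_iff.2 fun i => ?_)
  exact (hc _ (h.fourPoint_g i) (h.bound i)).div (hc _ h.fourPoint h.abs_le)

theorem DriftData.measurable_gridDrift_empirical (h : DriftData f g κ) {α : Type*}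
    [MeasurableSpace α] {z : α → Fin N → E d} {x : α → E d} (hz : Measurable z)
    (hx : Measurable x) (s : ℕ → ℝ) (k : ℕ) :
    Measurable fun a => gridDrift f g (empirical (z a)) s k (x a) := by
  have hc : ∀ ψ : E d → ℝ, FourPoint ψ κ →
      Measurable fun a => mean ψ (empirical (z a)) (x a) (s k) := fun ψ hψ => by
    have := hψ.continuous.measurable
    simp_rw [mean_empirical]
    fun_prop
  refine (WithLp.measurable_toLp 2 _).comp (measurable_pi_iff.2 fun i => ?_)
  exact (hc _ (h.fourPoint_g i)).div (hc _ h.fourPoint)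

end Measurability

variable {d N : ℕ}

/-! ### Euler schemes on nested dyadic grids -/

section EulerScheme

theorem step_succ (p : ℕ) : step p = 2 * step (p + 1) := by
  simp only [step, pow_succ, mul_inv]
  rw [mul_comm, mul_assoc, inv_mul_cancel₀ (by norm_num), mul_one]

theorem step_pos (l : ℕ) : (0 : ℝ) < step l := by
  simp only [step]; positivity

theorem step_le_one (l : ℕ) : (step l : ℝ) ≤ 1 := by
  simp only [step]
  push_cast
  exact inv_le_one_of_one_le₀ (one_le_pow₀ (by norm_num))

theorem two_mul_step_succ_mul_pow (p : ℕ) : 2 * (step (p + 1) : ℝ) * (2 ^ p : ℕ) = 1 := by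
  simp only [step, pow_succ]
  push_cast
  field_simp

/-- The increments of `w` over the grid of mesh `Δ_l`. -/
noncomputable def increment (l : ℕ) (w : ℝ≥0 → E d) (k : ℕ) : E d :=
  w ((k + 1) * step l) - w (k * step l)

/-- The noise levels `√(1 - k Δ_l)`. -/
noncomputable def noiseLevel (l k : ℕ) : ℝ := √(1 - k * step l)

theorem euler_eq_scheme (β : E d → ℝ → E d) (l : ℕ) (w : ℝ≥0 → E d) (k : ℕ) :
    euler β l w k = scheme (step l : ℝ) (fun k x => β x (k * step l)) (increment l w) k := by
  induction k with
  | zero => rfl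
  | succ k ih => rw [euler, scheme, ih]; simp [increment]

/-- The coupling of consecutive levels: a coarse Brownian increment telescopes into two fine ones.
-/
theorem increment_eq_pairSum (p : ℕ) (w : ℝ≥0 → E d) :
    increment p w = pairSum (increment (p + 1) w) := by
  ext1 j
  have e1 : ((j : ℝ≥0) + 1) * step p = (((2 * j + 1 : ℕ) : ℝ≥0) + 1) * step (p + 1) := by
    rw [step_succ]; push_cast; ring
  have e2 : (j : ℝ≥0) * step p = ((2 * j : ℕ) : ℝ≥0) * step (p + 1) := by
    rw [step_succ]; push_cast; ring
  have e3 : ((2 * j + 1 : ℕ) : ℝ≥0) = ((2 * j : ℕ) : ℝ≥0) + 1 := by push_cast; ring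
  simp only [increment, pairSum, e1, e2, e3]
  abel

/-- The square root is Hölder of exponent one half, which matters near `t = 1`. No restriction on
`k` is needed, as `√` vanishes on negative arguments, past time `1`. -/
theorem abs_noiseLevel_sub_le (l k : ℕ) :
    |noiseLevel l (k + 1) - noiseLevel l k| ≤ √(step l : ℝ) := by
  have h := step_pos l
  have hle : noiseLevel l (k + 1) ≤ noiseLevel l k :=
    Real.sqrt_le_sqrt (by push_cast; nlinarith)
  rw [abs_sub_comm, abs_of_nonneg (sub_nonneg.2 hle), sub_le_iff_le_add]
  have h1 : 1 - (k : ℝ) * step l - step l ≤ noiseLevel l (k + 1) ^ 2 := by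
    rw [noiseLevel, Real.sq_sqrt']
    refine le_trans (le_of_eq ?_) (le_max_left _ _)
    push_cast; ring
  have h2 : 0 ≤ noiseLevel l (k + 1) := Real.sqrt_nonneg _
  refine Real.sqrt_le_iff.2 ⟨by positivity, ?_⟩
  nlinarith [Real.sq_sqrt h.le, mul_nonneg (Real.sqrt_nonneg (step l : ℝ)) h2]

variable {f : E d → ℝ}

theorem euler_drift_eq (hf : AssumptionA1 f) (l : ℕ) (w : ℝ≥0 → E d) (k : ℕ) :
    euler (drift f) l w k = scheme (step l : ℝ)
      (gridDrift f (fun k => partialDeriv k f) (stdGaussian (E d)) (noiseLevel l))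
      (increment l w) k := by
  rw [euler_eq_scheme]
  congr 1
  ext1 k; ext1 x
  exact drift_eq_ratioDrift hf x _

theorem euler_mcDrift_eq (hf : AssumptionA1 f) (l : ℕ) (w : ℝ≥0 → E d) (z : Fin N → E d)
    (k : ℕ) :
    euler (mcDrift f z) l w k = scheme (step l : ℝ)
      (gridDrift f (fun k => partialDeriv k f) (empirical z) (noiseLevel l))
      (increment l w) k := by
  rw [euler_eq_scheme]
  congr 1
  ext1 k; ext1 x
  exact mcDrift_eq_ratioDrift (hf.contDiff.differentiable (by norm_num)) z x _

theorem noiseLevel_two_mul (p : ℕ) :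
    noiseLevel p = fun j => noiseLevel (p + 1) (2 * j) := by
  ext1 j
  simp only [noiseLevel]
  rw [step_succ]
  push_cast
  ring_nf

theorem coe_step (p : ℕ) : (step p : ℝ) = 2 * (step (p + 1) : ℝ) := by
  rw [step_succ]; simp

theorem doubleDifference_eq (hf : AssumptionA1 f) (φ : E d → ℝ) (p : ℕ) (w : ℝ≥0 → E d)
    (z : Fin N → E d) :
    doubleDifference f φ (p + 1) w z =
      φ (scheme (step (p + 1)) (gridDrift f (fun k => partialDeriv k f) (empirical z)
        (noiseLevel (p + 1))) (increment (p + 1) w) (2 * 2 ^ p))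
      - φ (scheme (2 * step (p + 1)) (gridDrift f (fun k => partialDeriv k f) (empirical z)
        fun j => noiseLevel (p + 1) (2 * j)) (pairSum (increment (p + 1) w)) (2 ^ p))
      - φ (scheme (step (p + 1)) (gridDrift f (fun k => partialDeriv k f)
        (stdGaussian (E d)) (noiseLevel (p + 1))) (increment (p + 1) w) (2 * 2 ^ p))
      + φ (scheme (2 * step (p + 1)) (gridDrift f (fun k => partialDeriv k f)
        (stdGaussian (E d)) fun j => noiseLevel (p + 1) (2 * j))
        (pairSum (increment (p + 1) w)) (2 ^ p)) := by
  simp only [doubleDifference, eulerMC, eulerExact, Nat.add_sub_cancel, euler_drift_eq hf,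
    euler_mcDrift_eq hf]
  rw [noiseLevel_two_mul p, increment_eq_pairSum p, coe_step p, pow_succ, mul_comm (2 ^ p) 2]
  ring

end EulerScheme

/-! ### Brownian motion, Gaussian samples and the product law -/

section Probability

theorem exists_momentBound (d : ℕ) : ∃ M, MomentBound (stdGaussian (E d)) M := by
  have h2 : MemLp (fun z : E d => ‖z‖) 2 (stdGaussian (E d)) :=
    (ProbabilityTheory.IsGaussian.memLp_two_id (μ := stdGaussian (E d))).norm
  have hm := absMoment_nonneg (stdGaussian (E d))
  have hs := Real.sqrt_nonneg (∫ z, ‖z‖ ^ 2 ∂(stdGaussian (E d)))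
  refine ⟨1 + √(∫ z, ‖z‖ ^ 2 ∂(stdGaussian (E d))) + absMoment (stdGaussian (E d)),
    by linarith, ?_, by linarith⟩
  refine (L2Le.of_integral h2 hs (le_of_eq ?_)).mono_const (by linarith)
  rw [Real.sq_sqrt (integral_nonneg fun z => sq_nonneg _)]

theorem exists_fourPoint_of_isLip {φ : E d → ℝ}
    (h : ∀ k : Fin d, HasPartialDeriv k φ ∧ IsLip (partialDeriv k φ) ∧
      IsBoundedMeasurable (partialDeriv k φ)) : ∃ A, FourPoint φ A := by
  choose h1 h2 h3 using h
  choose L hL using fun k => (h2 k).2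
  choose K hK using fun k => (h3 k).2
  have hsum : ∀ k, |L k| + |K k| ≤ ∑ k, (|L k| + |K k|) := fun k =>
    Finset.single_le_sum (f := fun k => |L k| + |K k|) (fun i _ => by positivity)
      (Finset.mem_univ k)
  -- The absolute values make the constant nonnegative without a sign for the given bounds, also
  -- when `d = 0`.
  refine exists_fourPoint (K := ∑ k, (|L k| + |K k|))
    (Finset.sum_nonneg fun i _ => by positivity) h1 (fun k x => ?_) fun k x y => ?_
  · linarith [hK k x, hsum k, le_abs_self (K k), abs_nonneg (L k)]
  · refine (hL k x y).trans (mul_le_mul_of_nonneg_right ?_ (norm_nonneg _))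
    linarith [hsum k, le_abs_self (L k), abs_nonneg (K k)]

variable {Ω : Type*} [MeasurableSpace Ω] {P : Measure Ω} {W : ℝ≥0 → Ω → E d}

theorem IsBrownianMotion.aemeasurable (hW : IsBrownianMotion W P) (t : ℝ≥0) :
    AEMeasurable (W t) P :=
  (WithLp.measurable_toLp 2 (Fin d → ℝ)).comp_aemeasurable
    (aemeasurable_pi_iff.2 fun i => (hW.coord i).toIsPreBrownianReal.aemeasurable t)

/-- Each coordinate increment is a centred Gaussian of variance `|s - t|`; the factor `d` comes from
bounding the Euclidean norm by the sum of the coordinates. -/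
theorem IsBrownianMotion.l2Le_sub (hW : IsBrownianMotion W P) (s t : ℝ≥0) :
    L2Le P (fun ω => ‖W s ω - W t ω‖) (d * √|(s : ℝ) - t|) := by
  have h1 : ∀ i, L2Le P (fun ω => |W s ω i - W t ω i|) √|(s : ℝ) - t| := fun i => by
    have hl := (hW.coord i).toIsPreBrownianReal.hasLaw_sub s t
    set U : Ω → ℝ := (fun ω => W s ω i) - fun ω => W t ω i
    have hU : MemLp U 2 P := hl.hasGaussianLaw.memLp_two
    have hv : Var[U; P] = |(s : ℝ) - t| := by
      rw [hl.variance_eq, variance_id_gaussianReal]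
      simp [coe_nndist, Real.dist_eq]
    have hm : ∫ ω, U ω ∂P = 0 := by rw [hl.integral_eq, integral_id_gaussianReal]
    rw [variance_of_integral_eq_zero hU.1.aemeasurable hm] at hv
    refine (L2Le.of_integral hU (Real.sqrt_nonneg _) ?_).mono fun ω => (abs_abs _).le
    rw [Real.sq_sqrt (abs_nonneg _)]
    exact hv.le
  refine ((L2Le.sum Finset.univ fun i _ => h1 i).of_le (fun ω => norm_nonneg _)
    fun ω => norm_le_sum_abs _).mono_const ?_
  simp

theorem L2Le.map {α β : Type*} [MeasurableSpace α] [MeasurableSpace β] {μ : Measure α}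
    {T : α → β} (hT : AEMeasurable T μ) {F : β → ℝ} (hF : Measurable F) {c : ℝ}
    (h : L2Le μ (fun x => F (T x)) c) : L2Le (μ.map T) F c := by
  refine ⟨h.1, fun y => |F y|, hF.abs.aestronglyMeasurable, fun _ => le_rfl, ?_⟩
  have e : eLpNorm (fun y => |F y|) 2 (μ.map T) = eLpNorm F 2 (μ.map T) := eLpNorm_norm F
  rw [e, eLpNorm_map_measure hF.aestronglyMeasurable hT,
    ← ENNReal.pow_le_pow_left_iff (n := 2) (by norm_num), L2Le.eLpNorm_two_sq]
  exact h.lintegral_le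

theorem L2Le.comp {α β : Type*} [MeasurableSpace α] [MeasurableSpace β] {μ : Measure α}
    {T : α → β} (hT : AEMeasurable T μ) {F : β → ℝ} {c : ℝ} (h : L2Le (μ.map T) F c) :
    L2Le μ (fun x => F (T x)) c := by
  obtain ⟨h0, H, hH, hFH, hle⟩ := h
  refine ⟨h0, H ∘ T, hH.comp_aemeasurable hT, fun x => hFH _, ?_⟩
  rwa [← eLpNorm_map_measure hH hT]

/-- The path `w` set to zero outside of `T`. -/
noncomputable def restrictPath (T : Set ℝ≥0) (w : ℝ≥0 → E d) : ℝ≥0 → E d :=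
  T.indicator w

theorem measurable_restrictPath (T : Set ℝ≥0) :
    Measurable (restrictPath T : (ℝ≥0 → E d) → ℝ≥0 → E d) := by
  refine measurable_pi_iff.2 fun t => ?_
  by_cases ht : t ∈ T
  · simpa [restrictPath, ht] using measurable_pi_apply t
  · simp [restrictPath, ht]

/-- Each `W t` is only almost everywhere measurable, with its own null set; over countably many
times these sets have null union. -/
theorem aemeasurable_restrictPath {T : Set ℝ≥0} (hT : T.Countable)
    (hW : ∀ t, AEMeasurable (W t) P) :
    AEMeasurable (fun ω => restrictPath T fun t => W t ω) P := by
  classical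
  have : Countable T := hT.to_subtype
  have h1 : AEMeasurable (fun ω (t : T) => W t ω) P := aemeasurable_pi_iff.2 fun t => hW t
  have h2 : Measurable fun (v : T → E d) (t : ℝ≥0) => if h : t ∈ T then v ⟨t, h⟩ else 0 := by
    refine measurable_pi_iff.2 fun t => ?_
    by_cases ht : t ∈ T
    · simpa [ht] using measurable_pi_apply _
    · simp [ht]
  convert h2.comp_aemeasurable h1 using 1
  ext1 ω; ext1 t
  by_cases ht : t ∈ T <;> simp [restrictPath, ht]

/-- The schemes see the path only on the grid, so the restricted path may replace the full one. -/
theorem increment_restrictPath (l : ℕ) (w : ℝ≥0 → E d) :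
    increment l (restrictPath (Set.range fun k : ℕ => (k : ℝ≥0) * step l) w)
      = increment l w := by
  ext1 k
  have h1 : ((k : ℝ≥0) + 1) * step l ∈ Set.range fun k : ℕ => (k : ℝ≥0) * step l :=
    ⟨k + 1, by push_cast; rfl⟩
  have h2 : (k : ℝ≥0) * step l ∈ Set.range fun k : ℕ => (k : ℝ≥0) * step l := ⟨k, rfl⟩
  simp only [increment, restrictPath, Set.indicator_of_mem h1, Set.indicator_of_mem h2]

theorem measurable_increment (l k : ℕ) :
    Measurable fun w : ℝ≥0 → E d => increment l w k :=
  (measurable_pi_apply _).sub (measurable_pi_apply _)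

theorem DriftData.measurable_comp_scheme {f : E d → ℝ} {g : Fin d → E d → ℝ} {κ : ℝ}
    (h : DriftData f g κ) {γ : Measure (E d)} [IsProbabilityMeasure γ]
    (hγ : Integrable (fun z => ‖z‖) γ) {φ : E d → ℝ} (hφ : Measurable φ) (δ : ℝ) (s : ℕ → ℝ)
    {ξ : (ℝ≥0 → E d) → ℕ → E d} (hξ : ∀ k, Measurable fun w => ξ w k) (n : ℕ) :
    (Measurable fun q : (ℝ≥0 → E d) × (Fin N → E d) =>
      φ (scheme δ (gridDrift f g (empirical q.2) s) (ξ q.1) n)) ∧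
    Measurable fun q : (ℝ≥0 → E d) × (Fin N → E d) =>
      φ (scheme δ (gridDrift f g γ s) (ξ q.1) n) := by
  have hb : ∀ k, Measurable fun r : ((ℝ≥0 → E d) × (Fin N → E d)) × E d =>
      gridDrift f g (empirical r.1.2) s k r.2 := fun k =>
    h.measurable_gridDrift_empirical (measurable_snd.comp measurable_fst) measurable_snd s k
  have hb' : ∀ k, Measurable fun r : ((ℝ≥0 → E d) × (Fin N → E d)) × E d =>
      gridDrift f g γ s k r.2 := fun k =>
    Measurable.comp (g := gridDrift f g γ s k) (h.measurable_gridDrift γ hγ s k) measurable_snd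
  have hξ' : ∀ k, Measurable fun q : (ℝ≥0 → E d) × (Fin N → E d) => ξ q.1 k :=
    fun k => (hξ k).comp measurable_fst
  exact ⟨hφ.comp (measurable_scheme
      (b := fun q : (ℝ≥0 → E d) × (Fin N → E d) => gridDrift f g (empirical q.2) s) hb hξ' n),
    hφ.comp (measurable_scheme
      (b := fun _ : (ℝ≥0 → E d) × (Fin N → E d) => gridDrift f g γ s) hb' hξ' n)⟩

theorem measurable_doubleDifference {f : E d → ℝ} (hf : AssumptionA1 f) {φ : E d → ℝ}
    (hφ : Measurable φ) (p : ℕ) :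
    Measurable fun q : (ℝ≥0 → E d) × (Fin N → E d) =>
      doubleDifference f φ (p + 1) q.1 q.2 := by
  obtain ⟨κ, hκ⟩ := hf.exists_driftData
  obtain ⟨M, hM⟩ := exists_momentBound d
  have hξ : ∀ k, Measurable fun w : ℝ≥0 → E d => increment (p + 1) w k :=
    fun k => measurable_increment (p + 1) k
  have hξ2 : ∀ k, Measurable fun w : ℝ≥0 → E d => pairSum (increment (p + 1) w) k :=
    fun k => (hξ _).add (hξ _)
  have m1 := hκ.measurable_comp_scheme (N := N) hM.integrable hφ (step (p + 1))
    (noiseLevel (p + 1)) hξ (2 * 2 ^ p)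
  have m2 := hκ.measurable_comp_scheme (N := N) hM.integrable hφ (2 * step (p + 1))
    (fun j => noiseLevel (p + 1) (2 * j)) hξ2 (2 ^ p)
  have := ((m1.1.sub m2.1).sub m1.2).add m2.2
  convert this using 1
  ext1 q
  exact doubleDifference_eq hf φ p q.1 q.2

variable [IsProbabilityMeasure P]

theorem IsSamplingInput.map_samples {Z : Fin N → Ω → E d} (h : IsSamplingInput W Z P) :
    P.map (fun ω i => Z i ω) = Measure.pi fun _ : Fin N => stdGaussian (E d) := by
  rw [(iIndepFun_iff_map_fun_eq_pi_map fun i => (h.gaussian i).aemeasurable).1 h.indep_Z]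
  congr 1
  ext1 i
  exact (h.gaussian i).map_eq

/-- The `L²`-norm of the double difference is of order `(Δ_l / N)^{1/2}`. -/
theorem IsSamplingInput.l2Le_doubleDifference {f : E d → ℝ} (hf : AssumptionA1 f)
    {κ M A : ℝ} (hκ : DriftData f (fun k => partialDeriv k f) κ)
    (hM : MomentBound (stdGaussian (E d)) M) {φ : E d → ℝ} (hφ : FourPoint φ A)
    (hN : 1 ≤ N) (p : ℕ) {Z : Fin N → Ω → E d} (h : IsSamplingInput W Z P) :
    AEStronglyMeasurable
      (fun ω => doubleDifference f φ (p + 1) (fun t => W t ω) (fun i => Z i ω)) P ∧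
    L2Le P (fun ω => doubleDifference f φ (p + 1) (fun t => W t ω) (fun i => Z i ω))
      (finalConst d κ M d A * √(step (p + 1) : ℝ) / √N) := by
  -- A countable grid, so that the restricted path `V` is a.e. measurable and its law is available
  -- for the product decomposition `hlaw`.
  set T : Set ℝ≥0 := Set.range fun k : ℕ => (k : ℝ≥0) * step (p + 1) with hT
  set V : Ω → ℝ≥0 → E d := fun ω => restrictPath T fun t => W t ω with hV
  set S : Ω → Fin N → E d := fun ω i => Z i ω
  have hVm : AEMeasurable V P :=
    aemeasurable_restrictPath (Set.countable_range _) h.brownian.aemeasurable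
  have hSm : AEMeasurable S P := aemeasurable_pi_iff.2 fun i => (h.gaussian i).aemeasurable
  have hind : IndepFun V S P :=
    h.indep_W_Z.comp (measurable_restrictPath T) measurable_id
  have hlaw : P.map (fun ω => (V ω, S ω))
      = (P.map V).prod (Measure.pi fun _ : Fin N => stdGaussian (E d)) := by
    rw [(indepFun_iff_map_prod_eq_prod_map_map hVm hSm).1 hind, h.map_samples]
  have hFm := measurable_doubleDifference (N := N) hf hφ.continuous.measurable p
  have heq : ∀ ω, doubleDifference f φ (p + 1) (fun t => W t ω) (fun i => Z i ω)
      = doubleDifference f φ (p + 1) (V ω) (S ω) := fun ω => by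
    rw [doubleDifference_eq hf, doubleDifference_eq hf, hV, increment_restrictPath]
  have hξ : ∀ k, L2Le (P.map V) (fun w => ‖increment (p + 1) w k‖)
      (d * √(step (p + 1) : ℝ)) := fun k => by
    refine L2Le.map hVm (measurable_increment _ _).norm ?_
    have := h.brownian.l2Le_sub ((k + 1) * step (p + 1)) (k * step (p + 1))
    simp only [hV, hT, increment_restrictPath]
    have e : |((((k : ℝ≥0) + 1) * step (p + 1) : ℝ≥0) : ℝ) - ((k * step (p + 1) : ℝ≥0) : ℝ)|
        = step (p + 1) := by
      push_cast
      rw [add_mul, one_mul, add_sub_cancel_left, abs_of_pos (step_pos _)]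
    rwa [e] at this
  have : IsProbabilityMeasure (P.map V) := Measure.isProbabilityMeasure_map hVm
  have key := hκ.l2Le_prod_secondDifference hM hN (step_pos (p + 1)) (step_le_one (p + 1))
    (abs_noiseLevel_sub_le (p + 1)) hξ (Nat.cast_nonneg d)
    (two_mul_step_succ_mul_pow p).le hφ hFm fun q => doubleDifference_eq hf φ p q.1 q.2
  rw [← hlaw] at key
  simp_rw [heq]
  exact ⟨(hFm.comp_aemeasurable (hVm.prodMk hSm)).aestronglyMeasurable,
    key.comp (hVm.prodMk hSm)⟩

end Probability

end SchrodingerFollmer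

theorem proposition2 {d : ℕ} (f : SchrodingerFollmer.E d → ℝ)
    (hf : SchrodingerFollmer.AssumptionA1 f)
    (φ : SchrodingerFollmer.E d → ℝ)
    (hφ : SchrodingerFollmer.IsBoundedMeasurable φ)
    (hφ' : ∀ k : Fin d, SchrodingerFollmer.HasPartialDeriv k φ ∧
      SchrodingerFollmer.IsLip (SchrodingerFollmer.partialDeriv k φ) ∧
      SchrodingerFollmer.IsBoundedMeasurable (SchrodingerFollmer.partialDeriv k φ)) :
    ∃ C : ℝ, ∀ l N : ℕ, 1 ≤ l → 1 ≤ N →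
      ∀ (Ω : Type u) [MeasurableSpace Ω] (P : Measure Ω) [IsProbabilityMeasure P]
        (W : ℝ≥0 → Ω → SchrodingerFollmer.E d) (Z : Fin N → Ω → SchrodingerFollmer.E d),
        SchrodingerFollmer.IsSamplingInput W Z P →
        Integrable (fun ω =>
          (SchrodingerFollmer.doubleDifference f φ l (fun t => W t ω) (fun i => Z i ω)) ^ 2) P ∧
        ∫ ω, (SchrodingerFollmer.doubleDifference f φ l (fun t => W t ω) (fun i => Z i ω)) ^ 2 ∂P
          ≤ C * (SchrodingerFollmer.step l : ℝ) / (N : ℝ) := by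
  obtain ⟨κ, hκ⟩ := hf.exists_driftData
  obtain ⟨M, hM⟩ := SchrodingerFollmer.exists_momentBound d
  obtain ⟨A, hA⟩ := SchrodingerFollmer.exists_fourPoint_of_isLip hφ'
  -- The square of the `L²` constant; the second `d` is the constant in the size `d * √Δ_l` of the
  -- Brownian increments.
  refine ⟨SchrodingerFollmer.finalConst d κ M d A ^ 2, fun l N hl hN Ω _ P _ W Z h => ?_⟩
  obtain ⟨p, rfl⟩ : ∃ p, l = p + 1 := ⟨l - 1, by omega⟩
  obtain ⟨hm, hle⟩ := h.l2Le_doubleDifference hf hκ hM hA hN p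
  refine ⟨(hle.memLp hm).integrable_sq, (hle.integral_le hm).trans_eq ?_⟩
  rw [div_pow, mul_pow, Real.sq_sqrt (SchrodingerFollmer.step_pos _).le,
    Real.sq_sqrt (Nat.cast_nonneg N)]
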